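/- Let $n$ be a natural number, $[n]=\{1,\dots,n\}$, and let $\{A(t)\}_{t=0}^\infty$ be an independent random chain: a sequence of independent random $n\times n$ real matrices $A(t)=(a_{ij}(t))$ on a probability space, each almost surely row-stochastic (nonnegative entries, all row sums equal to $1$). Let $\bar A(t):=\mathbb E[A(t)]$ (entrywise) be the expected chain. Suppose that (a) $\{A(t)\}$ has the feedback property: there is a $\gamma>0$ such that $\mathbb E[a_{ii}(t)a_{ij}(t)]\ge\gamma\,\mathbb E[a_{ij}(t)]$ for all $t\ge 0$ and all distinct $i,j\in[n]$; (b) $\{\bar A(t)\}$ is approximately reciprocal: there are $p_0,\beta\in(0,\infty)$ such that, for all $S\subseteq[n]$ with complement $\bar S=[n]\setminus S$ and all integers $0\le t_0<t_1$, $$p_0\sum_{t=t_0}^{t_1-1}\sum_{i\in S}\sum_{j\in\bar S}\bar a_{ij}(t)\;\le\;\sum_{t=t_0}^{t_1-1}\sum_{i\in\bar S}\sum_{j\in S}\bar a_{ij}(t)+\beta .$$ For a sequence $B=\{B(t)\}_{t=0}^\infty$ of row-stochastic $n\times n$ matrices, its infinite flow graph $G^\infty_B$ is the undirected graph on $[n]$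 in which distinct $i,j$ are adjacent iff $\sum_{t=0}^\infty(b_{ij}(t)+b_{ji}(t))=\infty$. A trajectory of $B$ is a sequence $\{x(t)\}_{t\ge t_0}$ in $\mathbb R^n$ with $x(t+1)=B(t)x(t)$ for all $t\ge t_0$, where the starting time $t_0\ge0$ and the starting point $x(t_0)\in\mathbb R^n$ are arbitrary. $B$ is infinite flow stable if every trajectory of $B$ converges and satisfies $\lim_{t\to\infty}(x_i(t)-x_j(t))=0$ for every edge $\{i,j\}$ of $G^\infty_B$. Indices $i,j$ are mutually ergodic for $B$, written $i\leftrightarrow_B j$, if $\lim_{t\to\infty}(x_i(t)-x_j(t))=0$ for every trajectory of $B$. Then: (i) almost every realization of $\{A(t)\}$ is infinite flow stable; (ii) for almost every realization of $\{A(t)\}$, for all $i,j\in[n]$: $i\leftrightarrow_A j$ if and only if $i\leftrightarrow_{\bar A}j$; (iii) for almost every realization of $\{A(t)\}$, for all $i,j\in[n]$: $i$ and $j$ belong to the same connected component of $G^\infty_A$ if and only if they belong to the same connected component of $G^\infty_{\bar A}$. -/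

import Mathlib

open MeasureTheory ProbabilityTheory Filter Topology

/-- The Borel (product) sigma-algebra on real matrices: the entries generate it. -/
instance instMeasurableSpaceRealMatrix (n : ℕ) :
    MeasurableSpace (Matrix (Fin n) (Fin n) ℝ) :=
  inferInstanceAs (MeasurableSpace (Fin n → Fin n → ℝ))

/-- The total weight `1ᵀ M_{S S̄} 1` of the block of `M` with rows in `S` and columns outside
`S`. -/
def cutWeight {n : ℕ} (M : Matrix (Fin n) (Fin n) ℝ) (S : Finset (Fin n)) : ℝ :=
  ∑ i ∈ S, ∑ j ∈ Sᶜ, M i j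

/-- Approximate reciprocity of a sequence of matrices. -/
def ApproxReciprocal {n : ℕ} (A : ℕ → Matrix (Fin n) (Fin n) ℝ) : Prop :=
  ∃ p₀ β : ℝ, 0 < p₀ ∧ 0 < β ∧
    ∀ (S : Finset (Fin n)) (t₀ t₁ : ℕ), t₀ < t₁ →
      p₀ * ∑ t ∈ Finset.Ico t₀ t₁, cutWeight (A t) S
        ≤ ∑ t ∈ Finset.Ico t₀ t₁, cutWeight (A t) Sᶜ + β

/-- The infinite flow graph: distinct `i` and `j` are adjacent iff
`∑ t, (a_ij(t) + a_ji(t)) = ∞`. -/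
def infiniteFlowGraph {n : ℕ} (A : ℕ → Matrix (Fin n) (Fin n) ℝ) : SimpleGraph (Fin n) where
  Adj i j := i ≠ j ∧
    Tendsto (fun T : ℕ => ∑ t ∈ Finset.range T, (A t i j + A t j i)) atTop atTop
  symm := ⟨fun i j h => ⟨h.1.symm, by simpa only [add_comm] using h.2⟩⟩
  loopless := ⟨fun _ h => h.1 rfl⟩

/-- `x` follows the dynamics `x(t+1) = A(t) x(t)` from the starting time `t₀` on; the values of `x`
before `t₀` play no role, and `x t₀` is arbitrary. -/
def IsTrajectory {n : ℕ} (A : ℕ → Matrix (Fin n) (Fin n) ℝ) (t₀ : ℕ) (x : ℕ → Fin n → ℝ) : Prop :=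
  ∀ t, t₀ ≤ t → x (t + 1) = Matrix.mulVec (A t) (x t)

/-- Infinite flow stability: every trajectory converges, and the coordinates at the two ends of any
edge of the infinite flow graph merge asymptotically. -/
def InfiniteFlowStable {n : ℕ} (A : ℕ → Matrix (Fin n) (Fin n) ℝ) : Prop :=
  ∀ (t₀ : ℕ) (x : ℕ → Fin n → ℝ), IsTrajectory A t₀ x →
    (∃ l : Fin n → ℝ, Tendsto x atTop (𝓝 l)) ∧
    ∀ i j : Fin n, (infiniteFlowGraph A).Adj i j →
      Tendsto (fun t => x t i - x t j) atTop (𝓝 0)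

/-- `i` and `j` are mutually ergodic indices: `x_i(t) - x_j(t) → 0` along every trajectory,
whatever its starting time and starting point. -/
def MutuallyErgodic {n : ℕ} (A : ℕ → Matrix (Fin n) (Fin n) ℝ) (i j : Fin n) : Prop :=
  ∀ (t₀ : ℕ) (x : ℕ → Fin n → ℝ), IsTrajectory A t₀ x →
    Tendsto (fun t => x t i - x t j) atTop (𝓝 0)

/-- An independent random chain: a sequence of independent random matrices that are almost surely
row-stochastic. -/
structure IsIndependentRandomChain {n : ℕ} {Ω : Type*} [MeasurableSpace Ω] (μ : Measure Ω)
    (A : ℕ → Ω → Matrix (Fin n) (Fin n) ℝ) : Prop where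
  measurable : ∀ t, Measurable (A t)
  stochastic : ∀ t, ∀ᵐ ω ∂μ, A t ω ∈ Matrix.rowStochastic ℝ (Fin n)
  indep : iIndepFun A μ

/-- The feedback property: `E[a_ii(t) a_ij(t)] ≥ γ E[a_ij(t)]` for all `t` and all distinct
`i`, `j`, for some `γ > 0`. -/
def HasFeedbackProperty {n : ℕ} {Ω : Type*} [MeasurableSpace Ω] (μ : Measure Ω)
    (A : ℕ → Ω → Matrix (Fin n) (Fin n) ℝ) : Prop :=
  ∃ γ : ℝ, 0 < γ ∧ ∀ (t : ℕ) (i j : Fin n), i ≠ j →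
    γ * ∫ ω, A t ω i j ∂μ ≤ ∫ ω, A t ω i i * A t ω i j ∂μ

/-- The expected chain, `t ↦ E[A(t)]`, with the expectation taken entrywise. -/
noncomputable def expectedChain {n : ℕ} {Ω : Type*} [MeasurableSpace Ω] (μ : Measure Ω)
    (A : ℕ → Ω → Matrix (Fin n) (Fin n) ℝ) : ℕ → Matrix (Fin n) (Fin n) ℝ :=
  fun t => Matrix.of fun i j => ∫ ω, A t ω i j ∂μ

/-! Fix a horizon `T` and propagate weights backwards through the expected chain: `w(T) = 1`, `w(t)ᵀ
= w(t+1)ᵀ Ā(t)` (`costate`). For a trajectory `Y` independent of the present matrix, `∑ w_i(t)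
E[Y_i(t)²]` loses at each step the weighted variance of the averaging, and feedback bounds this loss
below by `γ ∑ w_i(t+1) E[∑_j a_ij (Y_i - Y_j)²]` (`sq_mulVec_add_le`, `integral_sq_mulVec_add_le`).
If `w ≥ c > 0` uniformly in `T` and `t`, the total expected disagreement is at most `n²/(γc)`, so
the disagreement is almost surely summable.

The uniform bound on `w` is where reciprocity enters (`exists_pos_le_sum`). The weight `w_i(t)` is
the final total of the trajectory started at the `i`-th basis vector. The induction is on the number
of indices outside a set `S` of large values. The values on `S` decay only through the weight that
`S` puts on its complement. If that weight is bounded, nothing is lost; otherwise reciprocity makes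
the complement put a definite weight on `S`, and this must lift an outside index to a fixed height,
which enlarges `S`. Indeed, the chain with `S` isolated is again reciprocal and covered by the
induction, so its backward weights are bounded below and the flow received from `S` cannot be lost.

The rest is mostly deterministic. Summable disagreement makes gaps between values persist, which
forces convergence and merging along edges of infinite flow. Conversely, the indicator of a
component, started late, stays split; so mutual ergodicity is reachability
(`mutuallyErgodic_iff_reachable`). A Borel–Cantelli argument identifies the random flow graph with
that of `Ā`, and `Ā` is itself a constant random chain satisfying the hypotheses. -/

/-! ### Cut weights and decay on a set of indices -/

section Reciprocity

variable {n : ℕ}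

/-- Since `1 + u / δ ≤ exp (u / δ)`, it suffices that `(1 - u) (1 + u / δ) ≥ 1`, which amounts to `u
(1 - δ - u) ≥ 0`. -/
lemma exp_neg_div_le_one_sub {δ u : ℝ} (hδ : 0 < δ) (hu : 0 ≤ u) (hu' : u ≤ 1 - δ) :
    Real.exp (-u / δ) ≤ 1 - u := by
  have h1 : u / δ + 1 ≤ Real.exp (u / δ) := Real.add_one_le_exp _
  have h2 : 0 < u / δ + 1 := by positivity
  have h3 : 1 ≤ (1 - u) * (u / δ + 1) := by
    have : (1 - u) * (u / δ + 1) = 1 + u * (1 - δ - u) / δ := by field_simp; ring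
    rw [this]
    have : 0 ≤ u * (1 - δ - u) / δ := by
      apply div_nonneg _ hδ.le
      exact mul_nonneg hu (by linarith)
    linarith
  rw [neg_div, Real.exp_neg]
  rw [inv_le_comm₀ (Real.exp_pos _) (by linarith)]
  refine le_trans ?_ h1
  rw [inv_le_iff_one_le_mul₀ (by linarith)]
  linarith

lemma cutWeight_nonneg {M : Matrix (Fin n) (Fin n) ℝ} (hM : ∀ i j, 0 ≤ M i j)
    (S : Finset (Fin n)) : 0 ≤ cutWeight M S :=
  Finset.sum_nonneg fun i _ => Finset.sum_nonneg fun j _ => hM i j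

lemma sum_compl_le_cutWeight {M : Matrix (Fin n) (Fin n) ℝ} (hM : ∀ i j, 0 ≤ M i j)
    {S : Finset (Fin n)} {i : Fin n} (hi : i ∈ S) : ∑ j ∈ Sᶜ, M i j ≤ cutWeight M S :=
  Finset.single_le_sum (f := fun i => ∑ j ∈ Sᶜ, M i j)
    (fun i _ => Finset.sum_nonneg fun j _ => hM i j) hi

lemma cutWeight_le_card {M : Matrix (Fin n) (Fin n) ℝ} (hM : M ∈ Matrix.rowStochastic ℝ (Fin n))
    (S : Finset (Fin n)) : cutWeight M S ≤ n := by
  have h : ∀ i ∈ S, ∑ j ∈ Sᶜ, M i j ≤ 1 := fun i _ => by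
    rw [← Matrix.sum_row_of_mem_rowStochastic hM i]
    exact Finset.sum_le_sum_of_subset_of_nonneg (Finset.subset_univ _) fun j _ _ => hM.1 i j
  calc cutWeight M S ≤ ∑ i ∈ S, (1 : ℝ) := Finset.sum_le_sum h
    _ = S.card := by simp
    _ ≤ n := by
      have := Finset.card_le_univ S
      rw [Fintype.card_fin] at this
      exact_mod_cast this

/-- `x` follows the dynamics of `A` on the time window `[s, T]`. -/
def IsTrajectoryOn (A : ℕ → Matrix (Fin n) (Fin n) ℝ) (s T : ℕ) (x : ℕ → Fin n → ℝ) : Prop :=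
  ∀ t, s ≤ t → t < T → x (t + 1) = Matrix.mulVec (A t) (x t)

lemma IsTrajectoryOn.mono {A : ℕ → Matrix (Fin n) (Fin n) ℝ} {s T s' T' : ℕ} {x : ℕ → Fin n → ℝ}
    (hx : IsTrajectoryOn A s T x) (hs : s ≤ s') (hT : T' ≤ T) : IsTrajectoryOn A s' T' x :=
  fun t h1 h2 => hx t (hs.trans h1) (h2.trans_le hT)

lemma IsTrajectoryOn.nonneg {A : ℕ → Matrix (Fin n) (Fin n) ℝ} {s T : ℕ} {x : ℕ → Fin n → ℝ}
    (hx : IsTrajectoryOn A s T x) (hA : ∀ t, A t ∈ Matrix.rowStochastic ℝ (Fin n))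
    (h0 : ∀ i, 0 ≤ x s i) : ∀ t, s ≤ t → t ≤ T → ∀ i, 0 ≤ x t i := by
  intro t hst
  induction t, hst using Nat.le_induction with
  | base => exact fun _ => h0
  | succ t hst ih =>
    intro htT i
    rw [hx t hst htT]
    exact Matrix.nonneg_mulVec_of_mem_rowStochastic (hA t) (ih (by omega)) i

/-- The values on `S` decay at most exponentially in the flow that `S` receives from outside. -/
lemma IsTrajectoryOn.mul_exp_le {A : ℕ → Matrix (Fin n) (Fin n) ℝ} {s T : ℕ} {x : ℕ → Fin n → ℝ}
    (hx : IsTrajectoryOn A s T x) (hA : ∀ t, A t ∈ Matrix.rowStochastic ℝ (Fin n))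
    {δ : ℝ} (hδ : 0 < δ) (hdiag : ∀ t i, δ ≤ A t i i)
    (h0 : ∀ i, 0 ≤ x s i) {S : Finset (Fin n)} {a : ℝ} (ha : 0 ≤ a) (hS : ∀ i ∈ S, a ≤ x s i) :
    ∀ t, s ≤ t → t ≤ T → ∀ i ∈ S,
      a * Real.exp (-(∑ r ∈ Finset.Ico s t, cutWeight (A r) S) / δ) ≤ x t i := by
  intro t hst
  induction t, hst using Nat.le_induction with
  | base => exact fun _ => by simpa using hS
  | succ t hst ih =>
    intro htT i hi
    have ih' := ih (by omega)
    set m := a * Real.exp (-(∑ r ∈ Finset.Ico s t, cutWeight (A r) S) / δ) with hm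
    have hm0 : 0 ≤ m := by positivity
    have hxt := hx.nonneg hA h0 t hst (by omega)
    set u := ∑ j ∈ Sᶜ, A t i j with hu
    have hsum : ∑ j ∈ S, A t i j = 1 - u := by
      rw [← Matrix.sum_row_of_mem_rowStochastic (hA t) i, hu, ← Finset.sum_add_sum_compl S]
      ring
    have hu0 : 0 ≤ u := Finset.sum_nonneg fun j _ => (hA t).1 i j
    -- The diagonal weight of `i` stays inside `S`, which keeps the loss `u` away from `1`.
    have hu1 : u ≤ 1 - δ := by
      have : A t i i ≤ ∑ j ∈ S, A t i j :=
        Finset.single_le_sum (f := fun j => A t i j) (fun j _ => (hA t).1 i j) hi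
      linarith [hdiag t i]
    have hstep : m * (1 - u) ≤ x (t + 1) i := by
      rw [hx t hst htT]
      simp only [Matrix.mulVec, dotProduct]
      calc m * (1 - u) = ∑ j ∈ S, A t i j * m := by rw [← Finset.sum_mul, hsum]; ring
        _ ≤ ∑ j ∈ S, A t i j * x t j := Finset.sum_le_sum fun j hj =>
            mul_le_mul_of_nonneg_left (ih' j hj) ((hA t).1 i j)
        _ ≤ ∑ j, A t i j * x t j :=
            Finset.sum_le_sum_of_subset_of_nonneg (Finset.subset_univ _) fun j _ _ =>
              mul_nonneg ((hA t).1 i j) (hxt j)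
    refine le_trans ?_ hstep
    rw [Finset.sum_Ico_succ_top hst, neg_add, add_div, Real.exp_add, ← mul_assoc]
    refine mul_le_mul_of_nonneg_left ?_ hm0
    refine le_trans (Real.exp_le_exp.2 ?_) (exp_neg_div_le_one_sub hδ hu0 hu1)
    have := sum_compl_le_cutWeight (hA t).1 hi
    gcongr

/-! ### Reciprocity on a window and isolation of a set -/

/-- A row-stochastic chain with diagonal entries at least `δ`, in which the indices outside `U` are
isolated, and which is approximately reciprocal on the time window `[s, T]`. -/
structure IsReciprocalOn (A : ℕ → Matrix (Fin n) (Fin n) ℝ) (U : Finset (Fin n)) (δ p β : ℝ)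
    (s T : ℕ) : Prop where
  stochastic : ∀ t, A t ∈ Matrix.rowStochastic ℝ (Fin n)
  diag : ∀ t i, δ ≤ A t i i
  isolated : ∀ t i j, i ≠ j → i ∉ U ∨ j ∉ U → A t i j = 0
  recip : ∀ (V : Finset (Fin n)) (t₀ t₁ : ℕ), s ≤ t₀ → t₀ < t₁ → t₁ ≤ T →
    p * ∑ t ∈ Finset.Ico t₀ t₁, cutWeight (A t) V
      ≤ ∑ t ∈ Finset.Ico t₀ t₁, cutWeight (A t) Vᶜ + β

lemma IsReciprocalOn.mono {A : ℕ → Matrix (Fin n) (Fin n) ℝ} {U : Finset (Fin n)} {δ p β : ℝ}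
    {s T s' T' : ℕ} (h : IsReciprocalOn A U δ p β s T) (hs : s ≤ s') (hT : T' ≤ T) :
    IsReciprocalOn A U δ p β s' T' :=
  ⟨h.stochastic, h.diag, h.isolated, fun V t₀ t₁ h1 h2 h3 =>
    h.recip V t₀ t₁ (hs.trans h1) h2 (h3.trans hT)⟩

/-- The matrix obtained from `M` by isolating the indices in `S`: the weights from and to `S` are
moved to the diagonal. -/
def isolate (M : Matrix (Fin n) (Fin n) ℝ) (S : Finset (Fin n)) : Matrix (Fin n) (Fin n) ℝ :=
  Matrix.of fun i j => (if i ∈ S ∨ j ∈ S then 0 else M i j) +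
    if i = j then ∑ k, (if i ∈ S ∨ k ∈ S then M i k else 0) else 0

lemma isolate_apply_of_ne {M : Matrix (Fin n) (Fin n) ℝ} {S : Finset (Fin n)} {i j : Fin n}
    (h : i ≠ j) : isolate M S i j = if i ∈ S ∨ j ∈ S then 0 else M i j := by
  simp [isolate, h]

lemma isolate_mem_rowStochastic {M : Matrix (Fin n) (Fin n) ℝ}
    (hM : M ∈ Matrix.rowStochastic ℝ (Fin n)) (S : Finset (Fin n)) :
    isolate M S ∈ Matrix.rowStochastic ℝ (Fin n) := by
  rw [Matrix.mem_rowStochastic_iff_sum]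
  constructor
  · intro i j
    have h1 : 0 ≤ ∑ k, (if i ∈ S ∨ k ∈ S then M i k else 0) :=
      Finset.sum_nonneg fun k _ => by split_ifs; exacts [hM.1 i k, le_rfl]
    have h2 := hM.1 i j
    simp only [isolate, Matrix.of_apply]
    split_ifs <;> linarith
  · intro i
    simp only [isolate, Matrix.of_apply, Finset.sum_add_distrib, Finset.sum_ite_eq,
      Finset.mem_univ, if_true]
    rw [← Finset.sum_add_distrib, ← Matrix.sum_row_of_mem_rowStochastic hM i]
    refine Finset.sum_congr rfl fun j _ => ?_
    split_ifs <;> simp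

lemma le_isolate_diag {M : Matrix (Fin n) (Fin n) ℝ} (hM : ∀ i j, 0 ≤ M i j)
    (S : Finset (Fin n)) (i : Fin n) : M i i ≤ isolate M S i i := by
  have h0 : ∀ k, 0 ≤ (if i ∈ S ∨ k ∈ S then M i k else 0) := fun k => by
    split_ifs; exacts [hM i k, le_rfl]
  have h1 : (if i ∈ S ∨ i ∈ S then M i i else 0) ≤ ∑ k, (if i ∈ S ∨ k ∈ S then M i k else 0) :=
    Finset.single_le_sum (fun k _ => h0 k) (Finset.mem_univ i)
  simp only [isolate, Matrix.of_apply, if_true]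
  split_ifs at h1 ⊢ <;> linarith

lemma cutWeight_eq_sum_product (M : Matrix (Fin n) (Fin n) ℝ) (S : Finset (Fin n)) :
    cutWeight M S = ∑ q ∈ S ×ˢ Sᶜ, M q.1 q.2 := by
  rw [Finset.sum_product]
  rfl

/-- An off-diagonal entry that survives isolation has both ends outside `S`, so if it crosses the
cut of `V` it also crosses that of `V \ S`. -/
lemma cutWeight_isolate_le {M : Matrix (Fin n) (Fin n) ℝ} (hM : ∀ i j, 0 ≤ M i j)
    (S V : Finset (Fin n)) : cutWeight (isolate M S) V ≤ cutWeight M (V \ S) := by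
  simp only [cutWeight_eq_sum_product]
  have h : ∀ q ∈ V ×ˢ Vᶜ, isolate M S q.1 q.2 = if q.1 ∈ S ∨ q.2 ∈ S then 0 else M q.1 q.2 := by
    rintro ⟨i, j⟩ hq
    simp only [Finset.mem_product, Finset.mem_compl] at hq
    exact isolate_apply_of_ne fun hij : i = j => hq.2 (hij ▸ hq.1)
  rw [Finset.sum_congr rfl h, Finset.sum_ite, Finset.sum_const_zero, zero_add]
  refine Finset.sum_le_sum_of_subset_of_nonneg ?_ fun q _ _ => hM _ _
  rintro ⟨i, j⟩ hq
  simp only [Finset.mem_filter, Finset.mem_product, Finset.mem_compl, Finset.mem_sdiff] at hq ⊢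
  tauto

/-- An entry from a row outside `V \ S` to a column in `V \ S` either has its row in `S`, and
belongs to the cut of `S`, or has both ends outside `S` and survives isolation. -/
lemma cutWeight_compl_le_isolate {M : Matrix (Fin n) (Fin n) ℝ} (hM : ∀ i j, 0 ≤ M i j)
    (S V : Finset (Fin n)) :
    cutWeight M (V \ S)ᶜ ≤ cutWeight (isolate M S) Vᶜ + cutWeight M S := by
  simp only [cutWeight_eq_sum_product]
  have h : ∀ q ∈ Vᶜ ×ˢ Vᶜᶜ,
      isolate M S q.1 q.2 = if q.1 ∈ S ∨ q.2 ∈ S then 0 else M q.1 q.2 := by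
    rintro ⟨i, j⟩ hq
    simp only [Finset.mem_product, Finset.mem_compl] at hq
    exact isolate_apply_of_ne fun hij : i = j => hq.2 (hij ▸ hq.1)
  rw [Finset.sum_congr rfl h, Finset.sum_ite, Finset.sum_const_zero, zero_add,
    ← Finset.sum_filter_add_sum_filter_not ((V \ S)ᶜ ×ˢ (V \ S)ᶜᶜ) (fun q => ¬ q.1 ∈ S)]
  refine add_le_add ?_ ?_ <;>
  · refine Finset.sum_le_sum_of_subset_of_nonneg ?_ fun q _ _ => hM _ _
    rintro ⟨i, j⟩ hq
    simp only [Finset.mem_filter, Finset.mem_product, Finset.mem_compl, Finset.mem_sdiff] at hq ⊢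
    tauto

/-- Reciprocity of `A` is applied to `V \ S`; the surplus on the right consists of entries in the
cut of `S`, whose total `K` is absorbed into `β`. -/
lemma IsReciprocalOn.isolate {A : ℕ → Matrix (Fin n) (Fin n) ℝ} {U : Finset (Fin n)} {δ p β : ℝ}
    {s T : ℕ} (h : IsReciprocalOn A U δ p β s T) (hp : 0 ≤ p) (S : Finset (Fin n)) {K : ℝ}
    (hK : ∑ t ∈ Finset.Ico s T, cutWeight (A t) S ≤ K) :
    IsReciprocalOn (fun t => isolate (A t) S) (U \ S) δ p (β + K) s T where
  stochastic t := isolate_mem_rowStochastic (h.stochastic t) S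
  diag t i := (h.diag t i).trans (le_isolate_diag (h.stochastic t).1 S i)
  isolated t i j hij hU := by
    rw [isolate_apply_of_ne hij]
    split_ifs with hS
    · rfl
    · push Not at hS
      refine h.isolated t i j hij ?_
      simp only [Finset.mem_sdiff] at hU
      tauto
  recip V t₀ t₁ h1 h2 h3 := by
    have e1 : ∑ t ∈ Finset.Ico t₀ t₁, cutWeight (_root_.isolate (A t) S) V ≤
        ∑ t ∈ Finset.Ico t₀ t₁, cutWeight (A t) (V \ S) :=
      Finset.sum_le_sum fun t _ => cutWeight_isolate_le (h.stochastic t).1 S V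
    have e2 : ∑ t ∈ Finset.Ico t₀ t₁, cutWeight (A t) (V \ S)ᶜ ≤
        ∑ t ∈ Finset.Ico t₀ t₁, cutWeight (_root_.isolate (A t) S) Vᶜ +
        ∑ t ∈ Finset.Ico t₀ t₁, cutWeight (A t) S := by
      rw [← Finset.sum_add_distrib]
      exact Finset.sum_le_sum fun t _ => cutWeight_compl_le_isolate (h.stochastic t).1 S V
    have e3 : ∑ t ∈ Finset.Ico t₀ t₁, cutWeight (A t) S ≤
        ∑ t ∈ Finset.Ico s T, cutWeight (A t) S :=
      Finset.sum_le_sum_of_subset_of_nonneg (Finset.Ico_subset_Ico h1 h3) fun t _ _ =>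
        cutWeight_nonneg (h.stochastic t).1 S
    have e4 := h.recip (V \ S) t₀ t₁ h1 h2 h3
    have e5 := mul_le_mul_of_nonneg_left e1 hp
    linarith

/-! ### Transition matrices and backward weights -/

/-- `A(s + k - 1) ⋯ A(s + 1) A(s)`. -/
def transition (A : ℕ → Matrix (Fin n) (Fin n) ℝ) (s : ℕ) : ℕ → Matrix (Fin n) (Fin n) ℝ
  | 0 => 1
  | k + 1 => A (s + k) * transition A s k

lemma transition_succ (A : ℕ → Matrix (Fin n) (Fin n) ℝ) (s k : ℕ) :
    transition A s (k + 1) = A (s + k) * transition A s k := rfl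

lemma transition_succ' (A : ℕ → Matrix (Fin n) (Fin n) ℝ) (s k : ℕ) :
    transition A s (k + 1) = transition A (s + 1) k * A s := by
  induction k with
  | zero => simp [transition]
  | succ k ih =>
    rw [transition_succ, ih, transition_succ, Matrix.mul_assoc,
      show s + (k + 1) = s + 1 + k by ring]

lemma transition_mem_rowStochastic {A : ℕ → Matrix (Fin n) (Fin n) ℝ}
    (hA : ∀ t, A t ∈ Matrix.rowStochastic ℝ (Fin n)) (s k : ℕ) :
    transition A s k ∈ Matrix.rowStochastic ℝ (Fin n) := by
  induction k with
  | zero => exact one_mem _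
  | succ k ih => exact mul_mem (hA _) ih

/-- Weights `w(t)` on `[s, T]` with `w(T) = 1` and `w(t)ᵀ = w(t+1)ᵀ A(t)`. -/
def costate (A : ℕ → Matrix (Fin n) (Fin n) ℝ) (T t : ℕ) : Fin n → ℝ :=
  Matrix.vecMul 1 (transition A t (T - t))

lemma costate_self (A : ℕ → Matrix (Fin n) (Fin n) ℝ) (T : ℕ) : costate A T T = 1 := by
  simp [costate, transition]

lemma costate_eq (A : ℕ → Matrix (Fin n) (Fin n) ℝ) {T t : ℕ} (h : t < T) :
    costate A T t = Matrix.vecMul (costate A T (t + 1)) (A t) := by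
  rw [costate, costate, Matrix.vecMul_vecMul, ← transition_succ',
    show T - (t + 1) + 1 = T - t by omega]

lemma costate_nonneg {A : ℕ → Matrix (Fin n) (Fin n) ℝ}
    (hA : ∀ t, A t ∈ Matrix.rowStochastic ℝ (Fin n)) (T t : ℕ) (i : Fin n) :
    0 ≤ costate A T t i :=
  Matrix.nonneg_vecMul_of_mem_rowStochastic (transition_mem_rowStochastic hA _ _)
    (fun _ => zero_le_one) i

lemma costate_le {A : ℕ → Matrix (Fin n) (Fin n) ℝ}
    (hA : ∀ t, A t ∈ Matrix.rowStochastic ℝ (Fin n)) (T t : ℕ) (i : Fin n) :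
    costate A T t i ≤ n := by
  have : ∀ j, transition A t (T - t) j i ≤ 1 := fun j =>
    Matrix.le_one_of_mem_rowStochastic (transition_mem_rowStochastic hA _ _)
  simp only [costate, Matrix.vecMul, dotProduct, Pi.one_apply, one_mul]
  calc _ ≤ ∑ j : Fin n, (1 : ℝ) := Finset.sum_le_sum fun j _ => this j
    _ = n := by simp

/-- `costate A T t i` is the final total of the trajectory that starts from the `i`-th basis vector
at time `t`. -/
lemma le_costate {A : ℕ → Matrix (Fin n) (Fin n) ℝ} {T t : ℕ} {c : ℝ} {i : Fin n}
    (h : ∀ x : ℕ → Fin n → ℝ, IsTrajectoryOn A t T x → (∀ j, 0 ≤ x t j) → 1 ≤ x t i →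
      c ≤ ∑ j, x T j) : c ≤ costate A T t i := by
  have := h (fun r j => transition A t (r - t) j i) ?_ ?_ ?_
  · simpa [costate, Matrix.vecMul, dotProduct] using this
  · intro r h1 h2
    ext j
    change transition A t (r + 1 - t) j i = _
    rw [show r + 1 - t = r - t + 1 by omega, transition_succ, show t + (r - t) = r by omega]
    rfl
  · intro j
    simp only [Nat.sub_self, transition, Matrix.one_apply]
    split_ifs <;> norm_num
  · simp [transition]

end Reciprocity

/-! ### Uniform lower bound on the backward weights -/

section LowerBound

variable {n : ℕ}

lemma isolate_mulVec_of_mem {M : Matrix (Fin n) (Fin n) ℝ} {S : Finset (Fin n)} {i : Fin n}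
    (hi : i ∈ S) {y : Fin n → ℝ} (hy : ∀ j ∈ S, y j = 0) : (isolate M S).mulVec y i = 0 := by
  simp only [Matrix.mulVec, dotProduct]
  refine Finset.sum_eq_zero fun j _ => ?_
  by_cases hj : j ∈ S
  · rw [hy j hj, mul_zero]
  · rw [isolate_apply_of_ne (by rintro rfl; exact hj hi), if_pos (Or.inl hi), zero_mul]

lemma isolate_mulVec_of_notMem {M : Matrix (Fin n) (Fin n) ℝ} {S : Finset (Fin n)} {i : Fin n}
    (hi : i ∉ S) (y : Fin n → ℝ) :
    (isolate M S).mulVec y i = ∑ j ∈ Sᶜ, M i j * y j + (∑ j ∈ S, M i j) * y i := by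
  have h : ∀ j, isolate M S i j * y j = (if j ∈ Sᶜ then M i j * y j else 0) +
      if i = j then (∑ j ∈ S, M i j) * y j else 0 := by
    intro j
    have : ∑ k, (if i ∈ S ∨ k ∈ S then M i k else 0) = ∑ j ∈ S, M i j := by
      rw [← Finset.sum_filter]
      exact Finset.sum_congr (by ext; simp [hi]) fun _ _ => rfl
    simp only [isolate, Matrix.of_apply, hi, false_or, Finset.mem_compl]
    split_ifs <;> simp_all; ring
  simp only [Matrix.mulVec, dotProduct, h, Finset.sum_add_distrib, Finset.sum_ite_eq,
    Finset.mem_univ, if_true, Finset.sum_ite_mem, Finset.univ_inter]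

/-- If `S` stays above the level `m` while the other indices stay below `m / 2`, then the weighted
total of the other indices grows with the flow that they receive from `S`. -/
lemma IsTrajectoryOn.mul_le_costate_dotProduct {A : ℕ → Matrix (Fin n) (Fin n) ℝ} {s T : ℕ}
    {x : ℕ → Fin n → ℝ} (hx : IsTrajectoryOn A s T x)
    (hA : ∀ t, A t ∈ Matrix.rowStochastic ℝ (Fin n)) (h0 : ∀ i, 0 ≤ x s i)
    {S : Finset (Fin n)} {m c : ℝ} (hm : 0 ≤ m)
    (hS : ∀ t, s ≤ t → t ≤ T → ∀ i ∈ S, m ≤ x t i)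
    (hS' : ∀ t, s ≤ t → t ≤ T → ∀ i ∉ S, x t i ≤ m / 2)
    (hw : ∀ t, s ≤ t → t ≤ T → ∀ i, c ≤ costate (fun t => isolate (A t) S) T t i) :
    ∀ t, s ≤ t → t ≤ T → c * (m / 2) * ∑ r ∈ Finset.Ico s t, cutWeight (A r) Sᶜ ≤
      costate (fun t => isolate (A t) S) T t ⬝ᵥ fun i => if i ∈ S then 0 else x t i := by
  set B := fun t => isolate (A t) S with hB
  have hBs : ∀ t, B t ∈ Matrix.rowStochastic ℝ (Fin n) := fun t =>
    isolate_mem_rowStochastic (hA t) S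
  intro t hst
  induction t, hst using Nat.le_induction with
  | base =>
    intro hsT
    simp only [Finset.Ico_self, Finset.sum_empty, mul_zero]
    refine Finset.sum_nonneg fun i _ => mul_nonneg (costate_nonneg hBs _ _ i) ?_
    beta_reduce
    split_ifs; exacts [le_rfl, h0 i]
  | succ t hst ih =>
    intro htT
    have ih := ih (by omega)
    rw [Finset.sum_Ico_succ_top hst, mul_add]
    rw [costate_eq B (show t < T from htT), ← Matrix.dotProduct_mulVec] at ih
    set w := costate B T (t + 1) with hwdef
    -- The isolated chain replaces each `x t j` with `j ∈ S` by `x t i`. As `x t j ≥ m` and `x t i ≤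
    -- m / 2`, it falls short by at least `m / 2` per unit of weight on `S`.
    have hstep : ∀ i, (B t).mulVec (fun i => if i ∈ S then 0 else x t i) i +
        (if i ∈ S then 0 else (∑ j ∈ S, A t i j) * (m / 2)) ≤
        if i ∈ S then 0 else x (t + 1) i := by
      intro i
      by_cases hi : i ∈ S
      · rw [hB, isolate_mulVec_of_mem hi (fun j hj => by simp [hj])]
        simp [hi]
      · rw [hB, isolate_mulVec_of_notMem hi, hx t hst htT]
        simp only [hi, if_false, Matrix.mulVec, dotProduct]
        rw [← Finset.sum_add_sum_compl S (fun j => A t i j * x t j)]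
        have e1 : ∑ j ∈ Sᶜ, A t i j * (if j ∈ S then 0 else x t j) = ∑ j ∈ Sᶜ, A t i j * x t j :=
          Finset.sum_congr rfl fun j hj => by rw [if_neg (Finset.mem_compl.1 hj)]
        have e2 : (∑ j ∈ S, A t i j) * m ≤ ∑ j ∈ S, A t i j * x t j := by
          rw [Finset.sum_mul]
          exact Finset.sum_le_sum fun j hj =>
            mul_le_mul_of_nonneg_left (hS t hst (by omega) j hj) ((hA t).1 i j)
        have e3 : (∑ j ∈ S, A t i j) * x t i ≤ (∑ j ∈ S, A t i j) * (m / 2) :=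
          mul_le_mul_of_nonneg_left (hS' t hst (by omega) i hi)
            (Finset.sum_nonneg fun j _ => (hA t).1 i j)
        rw [e1]
        linarith
    have hflow : c * (m / 2) * cutWeight (A t) Sᶜ ≤
        w ⬝ᵥ fun i => if i ∈ S then 0 else (∑ j ∈ S, A t i j) * (m / 2) := by
      have : (w ⬝ᵥ fun i => if i ∈ S then 0 else (∑ j ∈ S, A t i j) * (m / 2)) =
          ∑ i ∈ Sᶜ, w i * ((∑ j ∈ S, A t i j) * (m / 2)) := by
        simp only [dotProduct]
        rw [← Finset.sum_add_sum_compl S, Finset.sum_eq_zero (fun i hi => by simp [hi]), zero_add]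
        exact Finset.sum_congr rfl fun i hi => by rw [if_neg (Finset.mem_compl.1 hi)]
      rw [this, cutWeight, compl_compl, Finset.mul_sum]
      refine Finset.sum_le_sum fun i _ => ?_
      have h1 : 0 ≤ (∑ j ∈ S, A t i j) * (m / 2) :=
        mul_nonneg (Finset.sum_nonneg fun j _ => (hA t).1 i j) (by linarith)
      have := mul_le_mul_of_nonneg_right (hw (t + 1) (by omega) htT i) h1
      linarith
    calc _ ≤ w ⬝ᵥ (B t).mulVec (fun i => if i ∈ S then 0 else x t i) +
          w ⬝ᵥ fun i => if i ∈ S then 0 else (∑ j ∈ S, A t i j) * (m / 2) := add_le_add ih hflow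
      _ = w ⬝ᵥ ((B t).mulVec (fun i => if i ∈ S then 0 else x t i) +
          fun i => if i ∈ S then 0 else (∑ j ∈ S, A t i j) * (m / 2)) := (dotProduct_add _ _ _).symm
      _ ≤ _ := Finset.sum_le_sum fun i _ =>
          mul_le_mul_of_nonneg_left (hstep i) (costate_nonneg hBs _ _ i)

/-- The row of an isolated index is a basis vector, so its coordinate is frozen. -/
lemma IsReciprocalOn.apply_eq_of_notMem {A : ℕ → Matrix (Fin n) (Fin n) ℝ} {U : Finset (Fin n)}
    {δ p β : ℝ} {s T : ℕ} (h : IsReciprocalOn A U δ p β s T) {s' T' : ℕ} {x : ℕ → Fin n → ℝ}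
    (hx : IsTrajectoryOn A s' T' x) {i : Fin n} (hi : i ∉ U) :
    ∀ t, s' ≤ t → t ≤ T' → x t i = x s' i := by
  intro t hst
  induction t, hst using Nat.le_induction with
  | base => exact fun _ => rfl
  | succ t hst ih =>
    intro htT
    have hz : ∀ j, j ≠ i → A t i j = 0 := fun j hj => h.isolated t i j hj.symm (Or.inl hi)
    have h1 : A t i i = 1 := by
      rw [← Matrix.sum_row_of_mem_rowStochastic (h.stochastic t) i]
      exact (Finset.sum_eq_single i (fun j _ hj => hz j hj) (by simp)).symm
    rw [← ih (by omega), hx t hst htT]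
    simp only [Matrix.mulVec, dotProduct]
    rw [Finset.sum_eq_single i (fun j _ hj => by rw [hz j hj, zero_mul]) (by simp), h1, one_mul]

/-- Trajectories of an approximately reciprocal chain that are nonnegative and at least `1` on some
indices keep a total that is bounded below, uniformly in the time window. -/
theorem exists_pos_le_sum (n m : ℕ) : ∀ δ p β : ℝ, 0 < δ → 0 < p → 0 ≤ β → ∃ c : ℝ, 0 < c ∧
    ∀ (A : ℕ → Matrix (Fin n) (Fin n) ℝ) (U S : Finset (Fin n)) (s T : ℕ) (x : ℕ → Fin n → ℝ),
      IsReciprocalOn A U δ p β s T → S ⊆ U → S.Nonempty → (U \ S).card = m → s ≤ T →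
      IsTrajectoryOn A s T x → (∀ i, 0 ≤ x s i) → (∀ i ∈ S, 1 ≤ x s i) → c ≤ ∑ j, x T j := by
  induction m with
  | zero =>
    intro δ p β hδ hp hβ
    refine ⟨1, one_pos, ?_⟩
    intro A U S s T x hA hSU ⟨i, hi⟩ hcard hsT hx h0 h1
    have hUS : U ⊆ S := by
      rw [Finset.card_eq_zero, Finset.sdiff_eq_empty_iff_subset] at hcard
      exact hcard
    have hcut : ∀ t, cutWeight (A t) S = 0 := fun t =>
      Finset.sum_eq_zero fun i hi => Finset.sum_eq_zero fun j hj => by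
        rw [Finset.mem_compl] at hj
        exact hA.isolated t i j (by rintro rfl; exact hj hi) (Or.inr fun h => hj (hUS h))
    have := hx.mul_exp_le hA.stochastic hδ hA.diag h0 zero_le_one h1 T hsT le_rfl i hi
    simp only [hcut, Finset.sum_const_zero, neg_zero, zero_div, Real.exp_zero, mul_one] at this
    exact this.trans (Finset.single_le_sum (f := fun j => x T j)
      (fun j _ => hx.nonneg hA.stochastic h0 T hsT le_rfl j) (Finset.mem_univ i))
  | succ m ih =>
    intro δ p β hδ hp hβ
    -- With `p * M = 1 + β`, inflow above `M` forces outflow at least `1`.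
    set M := (1 + β) / p with hM
    have hM0 : 0 < M := by positivity
    -- `c₁` serves the chain with `S` isolated, whose reciprocity constant has grown by `M + n`;
    -- `c₂` serves the original chain with an enlarged `S`.
    obtain ⟨c₁, hc₁, h₁⟩ := ih δ p (β + (M + n)) hδ hp (by positivity)
    obtain ⟨c₂, hc₂, h₂⟩ := ih δ p β hδ hp hβ
    set μ := Real.exp (-(M + n) / δ) with hμ
    have hμ0 : 0 < μ := Real.exp_pos _
    set c₀ := min c₁ 1 with hc₀
    have hc₀0 : 0 < c₀ := lt_min hc₁ one_pos
    -- The first bound places indices below `a` at most halfway up to `S`; the second, with `n + 1`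
    -- in place of `n`, gives `n * a < c₀ * (μ / 2)`, the final contradiction.
    set a := min (μ / 2) (c₀ * (μ / 2) / (n + 1)) with ha
    have ha0 : 0 < a := lt_min (by positivity) (by positivity)
    refine ⟨min (Real.exp (-M / δ)) (min (c₂ * a) a), by positivity, ?_⟩
    intro A U S s T x hA hSU hSne hcard hsT hx h0 h1
    have hxT := hx.nonneg hA.stochastic h0 T hsT le_rfl
    have hle : ∀ i, x T i ≤ ∑ j, x T j := fun i =>
      Finset.single_le_sum (f := fun j => x T j) (fun j _ => hxT j) (Finset.mem_univ i)
    have hlow := hx.mul_exp_le hA.stochastic hδ hA.diag h0 zero_le_one h1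
    have hcut0 : ∀ t, 0 ≤ cutWeight (A t) S := fun t => cutWeight_nonneg (hA.stochastic t).1 S
    by_cases hflow : ∑ r ∈ Finset.Ico s T, cutWeight (A r) S ≤ M
    · obtain ⟨i, hi⟩ := hSne
      refine (min_le_left _ _).trans (le_trans ?_ (hle i))
      refine le_trans ?_ (hlow T hsT le_rfl i hi)
      rw [one_mul]
      gcongr
    refine (min_le_right _ _).trans ?_
    push Not at hflow
    -- the first time at which `S` has received more than `M`
    obtain ⟨T₁, hsT₁, hT₁T, hgt, hlt⟩ : ∃ T₁, s < T₁ ∧ T₁ ≤ T ∧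
        M < ∑ r ∈ Finset.Ico s T₁, cutWeight (A r) S ∧
        ∑ r ∈ Finset.Ico s T₁, cutWeight (A r) S ≤ M + n := by
      classical
      have hex : ∃ t, M < ∑ r ∈ Finset.Ico s t, cutWeight (A r) S := ⟨T, hflow⟩
      have hspec := Nat.find_spec hex
      have hmin := fun k => Nat.find_min hex (m := k)
      have hfT : Nat.find hex ≤ T := Nat.find_min' hex hflow
      set τ := Nat.find hex with hτ
      have hsτ : s < τ := by
        by_contra hcon
        rw [Finset.Ico_eq_empty_of_le (by omega), Finset.sum_empty] at hspec
        linarith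
      refine ⟨τ, hsτ, hfT, hspec, ?_⟩
      obtain ⟨k, hk⟩ : ∃ k, τ = k + 1 := ⟨τ - 1, by omega⟩
      have hkm := hmin k (by omega)
      rw [hk, Finset.sum_Ico_succ_top (by omega)]
      have := cutWeight_le_card (hA.stochastic k) S
      linarith
    have hx₁ : IsTrajectoryOn A s T₁ x := hx.mono le_rfl hT₁T
    have hlowμ : ∀ t, s ≤ t → t ≤ T₁ → ∀ i ∈ S, μ ≤ x t i := by
      intro t hst htT i hi
      refine le_trans ?_ (hlow t hst (by omega) i hi)
      rw [one_mul, hμ]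
      have : ∑ r ∈ Finset.Ico s t, cutWeight (A r) S ≤ M + n :=
        le_trans (Finset.sum_le_sum_of_subset_of_nonneg (Finset.Ico_subset_Ico le_rfl htT)
          fun r _ _ => hcut0 r) hlt
      gcongr
    by_cases hout : ∃ t, s ≤ t ∧ t ≤ T₁ ∧ ∃ i ∉ S, a ≤ x t i
    · obtain ⟨t, hst, htT₁, i, hiS, hai⟩ := hout
      have hxt : IsTrajectoryOn A t T x := hx.mono hst le_rfl
      by_cases hiU : i ∈ U
      · refine (min_le_left _ _).trans ?_
        -- Dividing by `a` brings the enlarged set back to height `1`.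
        have key := h₂ A U (insert i S) t T (fun r j => a⁻¹ * x r j) (hA.mono hst le_rfl)
          (Finset.insert_subset hiU hSU) (Finset.insert_nonempty _ _) ?_ (by omega) ?_ ?_ ?_
        · rw [← Finset.mul_sum, ← div_eq_inv_mul, le_div_iff₀ ha0] at key
          exact key
        · rw [Finset.sdiff_insert, Finset.card_erase_of_mem (by simp [hiU, hiS]), hcard]
          rfl
        · intro r hr1 hr2
          have := hxt r hr1 hr2
          change a⁻¹ • x (r + 1) = (A r).mulVec (a⁻¹ • x r)
          rw [this, Matrix.mulVec_smul]
        · intro j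
          exact mul_nonneg (inv_nonneg.2 ha0.le)
            (hx.nonneg hA.stochastic h0 t hst (by omega) j)
        · intro j hj
          have : a ≤ x t j := by
            rcases Finset.mem_insert.1 hj with rfl | hj
            · exact hai
            · have := hlowμ t hst htT₁ j hj
              have := min_le_left (μ / 2) (c₀ * (μ / 2) / (n + 1))
              linarith
          rw [← div_eq_inv_mul, le_div_iff₀ ha0, one_mul]
          exact this
      · refine (min_le_right _ _).trans ?_
        rw [← hA.apply_eq_of_notMem hxt hiU T (by omega) le_rfl] at hai
        exact hai.trans (hle i)
    -- If all outside indices stay below `a`, the outflow from `S` lifts their weighted total to `c₀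
    -- * (μ / 2)`, more than they can hold.
    · exfalso
      push Not at hout
      have hB := (hA.mono le_rfl hT₁T).isolate hp.le S hlt
      have hw : ∀ t, s ≤ t → t ≤ T₁ → ∀ i,
          c₀ ≤ costate (fun t => isolate (A t) S) T₁ t i := by
        intro t hst htT i
        refine le_costate fun z hz hz0 hz1 => ?_
        -- In the isolated chain `{i}` misses only `m` indices of `U \ S`, so the induction applies;
        -- an index outside `U \ S` is frozen and contributes `1`.
        by_cases hi : i ∈ U \ S
        · refine (min_le_left _ _).trans (h₁ _ (U \ S) {i} t T₁ z (hB.mono hst le_rfl)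
            (by simpa using hi) (Finset.singleton_nonempty i) ?_ htT hz hz0 (by simpa using hz1))
          rw [Finset.sdiff_singleton_eq_erase, Finset.card_erase_of_mem hi, hcard]
          rfl
        · refine (min_le_right _ _).trans ?_
          rw [← hB.apply_eq_of_notMem hz hi T₁ htT le_rfl] at hz1
          exact hz1.trans (Finset.single_le_sum (f := fun j => z T₁ j)
            (fun j _ => hz.nonneg hB.stochastic hz0 T₁ htT le_rfl j) (Finset.mem_univ i))
      have key := hx₁.mul_le_costate_dotProduct hA.stochastic h0 hμ0.le hlowμ
        (fun t hst htT i hi => (hout t hst htT i hi).le.trans (min_le_left _ _)) hw T₁ hsT₁.le le_rfl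
      rw [costate_self, one_dotProduct] at key
      have hrec := hA.recip S s T₁ le_rfl hsT₁ hT₁T
      have h1le : 1 ≤ ∑ r ∈ Finset.Ico s T₁, cutWeight (A r) Sᶜ := by
        have := mul_le_mul_of_nonneg_left hgt.le hp.le
        rw [hM, mul_div_cancel₀ _ hp.ne'] at this
        linarith
      have hup : ∑ i, (if i ∈ S then 0 else x T₁ i) ≤ n * a := by
        calc _ ≤ ∑ i : Fin n, a := Finset.sum_le_sum fun i _ => by
              split_ifs with hi
              exacts [ha0.le, (hout T₁ hsT₁.le le_rfl i hi).le]
          _ = n * a := by simp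
      have hcμ : 0 < c₀ * (μ / 2) := by positivity
      have h2 := mul_le_mul_of_nonneg_left h1le hcμ.le
      have h3 : (n + 1) * a ≤ c₀ * (μ / 2) := by
        have := min_le_right (μ / 2) (c₀ * (μ / 2) / (n + 1))
        rw [← ha, le_div_iff₀ (by positivity)] at this
        linarith
      linarith

/-- The backward weights of an approximately reciprocal chain with uniformly positive diagonal are
uniformly positive. -/
theorem ApproxReciprocal.exists_pos_le_costate {A : ℕ → Matrix (Fin n) (Fin n) ℝ}
    (hrec : ApproxReciprocal A) (hA : ∀ t, A t ∈ Matrix.rowStochastic ℝ (Fin n)) {δ : ℝ}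
    (hδ : 0 < δ) (hdiag : ∀ t i, δ ≤ A t i i) :
    ∃ c : ℝ, 0 < c ∧ ∀ T t i, t ≤ T → c ≤ costate A T t i := by
  obtain ⟨p, β, hp, hβ, h⟩ := hrec
  obtain ⟨c, hc, H⟩ := exists_pos_le_sum n (n - 1) δ p β hδ hp hβ.le
  refine ⟨c, hc, fun T t i htT => le_costate fun x hx h0 h1 => ?_⟩
  refine H A Finset.univ {i} t T x ⟨hA, hdiag, by simp, fun V t₀ t₁ _ h2 _ => h V t₀ t₁ h2⟩
    (by simp) (by simp) ?_ htT hx h0 (by simpa using h1)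
  rw [Finset.sdiff_singleton_eq_erase, Finset.card_erase_of_mem (Finset.mem_univ i)]
  simp

end LowerBound

/-! ### Deterministic consequences of summable disagreement -/

section Convergence

variable {n : ℕ}

/-- The weighted disagreement `∑ i j, M i j (x i - x j)²`. -/
def disagreement (M : Matrix (Fin n) (Fin n) ℝ) (x : Fin n → ℝ) : ℝ :=
  ∑ i, ∑ j, M i j * (x i - x j) ^ 2

lemma disagreement_nonneg {M : Matrix (Fin n) (Fin n) ℝ} (hM : ∀ i j, 0 ≤ M i j)
    (x : Fin n → ℝ) : 0 ≤ disagreement M x :=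
  Finset.sum_nonneg fun i _ => Finset.sum_nonneg fun j _ => mul_nonneg (hM i j) (sq_nonneg _)

lemma sum_le_disagreement {M : Matrix (Fin n) (Fin n) ℝ} (hM : ∀ i j, 0 ≤ M i j)
    (x : Fin n → ℝ) (i : Fin n) : ∑ j, M i j * (x i - x j) ^ 2 ≤ disagreement M x :=
  Finset.single_le_sum (f := fun i => ∑ j, M i j * (x i - x j) ^ 2)
    (fun i _ => Finset.sum_nonneg fun j _ => mul_nonneg (hM i j) (sq_nonneg _)) (Finset.mem_univ i)

lemma mul_le_disagreement {M : Matrix (Fin n) (Fin n) ℝ} (hM : ∀ i j, 0 ≤ M i j)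
    (x : Fin n → ℝ) (i j : Fin n) : M i j * (x i - x j) ^ 2 ≤ disagreement M x :=
  (Finset.single_le_sum (f := fun j => M i j * (x i - x j) ^ 2)
    (fun j _ => mul_nonneg (hM i j) (sq_nonneg _)) (Finset.mem_univ j)).trans
    (sum_le_disagreement hM x i)

lemma disagreement_neg (M : Matrix (Fin n) (Fin n) ℝ) (x : Fin n → ℝ) :
    disagreement M (-x) = disagreement M x := by
  simp only [disagreement, Pi.neg_apply]
  refine Finset.sum_congr rfl fun i _ => Finset.sum_congr rfl fun j _ => ?_
  ring

/-- A coordinate above `K` exceeds `x i` by at least `ε / 2`, so its excess is at most `2 / ε` times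
the squared difference; averaging over row `i` gives the bound. -/
lemma mulVec_le_of_separated {M : Matrix (Fin n) (Fin n) ℝ}
    (hM : M ∈ Matrix.rowStochastic ℝ (Fin n)) {x : Fin n → ℝ} {ε K : ℝ} (hε : 0 < ε) {i : Fin n}
    (hi : x i ≤ K) (h : ∀ j, x j ≤ K ∨ ε / 2 ≤ x j - x i) :
    M.mulVec x i ≤ K + 2 / ε * disagreement M x := by
  have hj : ∀ j, x j ≤ K + 2 / ε * (x i - x j) ^ 2 := by
    intro j
    rcases h j with h | h
    · have : 0 ≤ 2 / ε * (x i - x j) ^ 2 := by positivity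
      linarith
    · have : x j - x i ≤ 2 / ε * (x i - x j) ^ 2 := by
        rw [div_mul_eq_mul_div, le_div_iff₀ hε]
        nlinarith
      linarith
  calc M.mulVec x i = ∑ j, M i j * x j := rfl
    _ ≤ ∑ j, M i j * (K + 2 / ε * (x i - x j) ^ 2) :=
        Finset.sum_le_sum fun j _ => mul_le_mul_of_nonneg_left (hj j) (hM.1 i j)
    _ = K + 2 / ε * ∑ j, M i j * (x i - x j) ^ 2 := by
        simp only [mul_add, Finset.sum_add_distrib, ← Finset.sum_mul]
        rw [Matrix.sum_row_of_mem_rowStochastic hM i, one_mul, Finset.mul_sum]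
        congr 1
        exact Finset.sum_congr rfl fun j _ => by ring
    _ ≤ _ := by
        have := sum_le_disagreement hM.1 x i
        gcongr

/-- A gap of size `ε` between the values of a trajectory persists once the remaining disagreement is
small compared with `ε ^ 2`. -/
lemma IsTrajectory.separated {A : ℕ → Matrix (Fin n) (Fin n) ℝ} {s : ℕ} {x : ℕ → Fin n → ℝ}
    (hx : IsTrajectory A s x) (hA : ∀ t, A t ∈ Matrix.rowStochastic ℝ (Fin n)) {ε : ℝ}
    (hε : 0 < ε) {N : ℕ} (hN : s ≤ N)
    (hD : ∀ t, ∑ r ∈ Finset.Ico N t, disagreement (A r) (x r) ≤ ε ^ 2 / 8) {S : Set (Fin n)}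
    {u : ℝ} (hS : ∀ j ∈ S, u + ε ≤ x N j) (hS' : ∀ j ∉ S, x N j ≤ u) :
    ∀ t, N ≤ t →
      (∀ j ∈ S, u + ε - 2 / ε * ∑ r ∈ Finset.Ico N t, disagreement (A r) (x r) ≤ x t j) ∧
      ∀ j ∉ S, x t j ≤ u + 2 / ε * ∑ r ∈ Finset.Ico N t, disagreement (A r) (x r) := by
  intro t ht
  induction t, ht using Nat.le_induction with
  | base => simpa using ⟨hS, hS'⟩
  | succ t ht ih =>
    obtain ⟨ih1, ih2⟩ := ih
    -- Each side drifts by at most `ε / 4`, so the gap is still at least `ε / 2`, as the one-step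
    -- bound requires.
    have hsmall : 2 / ε * ∑ r ∈ Finset.Ico N t, disagreement (A r) (x r) ≤ ε / 4 := by
      calc _ ≤ 2 / ε * (ε ^ 2 / 8) := by gcongr; exact hD t
        _ = ε / 4 := by field_simp; ring
    set P := 2 / ε * ∑ r ∈ Finset.Ico N t, disagreement (A r) (x r)
    rw [Finset.sum_Ico_succ_top ht, mul_add, hx t (hN.trans ht)]
    constructor
    · intro j hj
      have := mulVec_le_of_separated (hA t) (x := -x t) (K := -(u + ε - P)) hε (i := j)
        (neg_le_neg (ih1 j hj)) fun k => by
          by_cases hk : k ∈ S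
          · exact Or.inl (neg_le_neg (ih1 k hk))
          · right
            have h1 := ih1 j hj
            have h2 := ih2 k hk
            simp only [Pi.neg_apply]
            linarith
      rw [disagreement_neg, Matrix.mulVec_neg, Pi.neg_apply] at this
      linarith
    · intro j hj
      have := mulVec_le_of_separated (hA t) (x := x t) (K := u + P) hε (i := j)
        (ih2 j hj) fun k => by
          by_cases hk : k ∈ S
          · right
            have h1 := ih1 k hk
            have h2 := ih2 j hj
            linarith
          · exact Or.inl (ih2 k hk)
      linarith

/-- Pigeonhole: `n` values cannot meet all of the `n + 1` disjoint open intervals of length `η`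
stacked above `b`. -/
lemma exists_gap (y : Fin n → ℝ) (b : ℝ) {η : ℝ} (hη : 0 < η) :
    ∃ k : ℕ, k ≤ n ∧ ∀ j, y j ≤ b + k * η ∨ b + k * η + η ≤ y j := by
  by_contra hcon
  push Not at hcon
  have hcon' : ∀ k : Fin (n + 1), ∃ j, b + (k : ℕ) * η < y j ∧ y j < b + (k : ℕ) * η + η :=
    fun k => hcon k (by omega)
  choose f hf using hcon'
  have hlt : ∀ k k' : Fin (n + 1), k < k' → f k ≠ f k' := by
    intro k k' hkk' heq
    have h1 := (hf k).2
    have h2 := (hf k').1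
    rw [heq] at h1
    have h3 : ((k : ℕ) : ℝ) + 1 ≤ (k' : ℕ) := by
      have : (k : ℕ) + 1 ≤ k' := hkk'
      exact_mod_cast this
    nlinarith
  have hinj : Function.Injective f := by
    intro k k' h
    rcases lt_trichotomy k k' with hlt' | heq | hgt
    · exact absurd h (hlt _ _ hlt')
    · exact heq
    · exact absurd h.symm (hlt _ _ hgt)
  have := Fintype.card_le_of_injective f hinj
  simp at this

lemma exists_sum_Ico_le {f : ℕ → ℝ} (hf : Summable f) (h0 : ∀ t, 0 ≤ f t) {ε : ℝ} (hε : 0 < ε) :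
    ∃ N₀, ∀ N, N₀ ≤ N → ∀ t, ∑ r ∈ Finset.Ico N t, f r ≤ ε := by
  have h := hf.hasSum.tendsto_sum_nat
  obtain ⟨N₀, hN₀⟩ := eventually_atTop.1 (h.eventually (lt_mem_nhds (sub_lt_self (∑' r, f r) hε)))
  refine ⟨N₀, fun N hN t => ?_⟩
  rcases le_total t N with htN | hNt
  · rw [Finset.Ico_eq_empty_of_le htN, Finset.sum_empty]
    exact hε.le
  · rw [Finset.sum_Ico_eq_sub _ hNt]
    have h1 := hN₀ N hN
    have h2 := hf.sum_le_tsum (Finset.range t) fun r _ => h0 r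
    linarith

/-- Some slab of width `η = ε / (n + 1)`, within `ε` above `x N i`, is free of values at time `N`.
Coordinate `i` starts below it and, once the remaining disagreement is small, enters it by at most
`η / 4`. -/
lemma IsTrajectory.eventually_le_add {A : ℕ → Matrix (Fin n) (Fin n) ℝ} {s : ℕ}
    {x : ℕ → Fin n → ℝ} (hx : IsTrajectory A s x)
    (hA : ∀ t, A t ∈ Matrix.rowStochastic ℝ (Fin n))
    (hD : Summable fun t => disagreement (A t) (x t)) {ε : ℝ} (hε : 0 < ε) (i : Fin n) :
    ∃ N₀, ∀ N, N₀ ≤ N → ∀ t, N ≤ t → x t i ≤ x N i + ε := by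
  set η := ε / (n + 1) with hη
  have hη0 : 0 < η := by positivity
  obtain ⟨N₀, hN₀⟩ := exists_sum_Ico_le hD (fun t => disagreement_nonneg (hA t).1 _)
    (show 0 < η ^ 2 / 8 by positivity)
  refine ⟨max N₀ s, fun N hN t hNt => ?_⟩
  obtain ⟨k, hk, hgap⟩ := exists_gap (x N) (x N i) hη0
  have hi : i ∉ {j | x N i + k * η < x N j} := by
    have : x N i ≤ x N i + k * η := le_add_of_nonneg_right (by positivity)
    exact not_lt.2 this
  have hsep := (hx.separated hA hη0 (le_of_max_le_right hN) (hN₀ N (le_of_max_le_left hN))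
    (S := {j | x N i + k * η < x N j}) (u := x N i + k * η)
    (fun j hj => (hgap j).resolve_left (not_le.2 hj)) (fun j hj => not_lt.1 hj) t hNt).2 i hi
  have hsmall : 2 / η * ∑ r ∈ Finset.Ico N t, disagreement (A r) (x r) ≤ η / 4 := by
    calc _ ≤ 2 / η * (η ^ 2 / 8) := by gcongr; exact hN₀ N (le_of_max_le_left hN) t
      _ = η / 4 := by field_simp; ring
  have hkn : (k : ℝ) * η ≤ n * η := by gcongr
  have : (n + 1) * η = ε := by rw [hη]; field_simp
  linarith

lemma IsTrajectory.neg {A : ℕ → Matrix (Fin n) (Fin n) ℝ} {s : ℕ} {x : ℕ → Fin n → ℝ}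
    (hx : IsTrajectory A s x) : IsTrajectory A s (fun t => -x t) := fun t ht => by
  beta_reduce
  rw [hx t ht, Matrix.mulVec_neg]

/-- Trajectories with summable disagreement converge. -/
theorem IsTrajectory.exists_tendsto {A : ℕ → Matrix (Fin n) (Fin n) ℝ} {s : ℕ}
    {x : ℕ → Fin n → ℝ} (hx : IsTrajectory A s x)
    (hA : ∀ t, A t ∈ Matrix.rowStochastic ℝ (Fin n))
    (hD : Summable fun t => disagreement (A t) (x t)) :
    ∃ l : Fin n → ℝ, Tendsto x atTop (𝓝 l) := by
  have h : ∀ i, ∃ l, Tendsto (fun t => x t i) atTop (𝓝 l) := by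
    intro i
    refine cauchySeq_tendsto_of_complete (Metric.cauchySeq_iff'.2 fun ε hε => ?_)
    obtain ⟨N₁, h₁⟩ := hx.eventually_le_add hA hD (half_pos hε) i
    obtain ⟨N₂, h₂⟩ := hx.neg.eventually_le_add hA
      (by simpa only [disagreement_neg] using hD) (half_pos hε) i
    refine ⟨max N₁ N₂, fun t ht => ?_⟩
    have e1 := h₁ _ (le_max_left N₁ N₂) t ht
    have e2 := h₂ _ (le_max_right N₁ N₂) t ht
    simp only [Pi.neg_apply] at e2
    rw [Real.dist_eq, abs_lt]
    constructor <;> linarith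
  choose l hl using h
  exact ⟨l, tendsto_pi_nhds.2 hl⟩

lemma infiniteFlowGraph_adj_iff {A : ℕ → Matrix (Fin n) (Fin n) ℝ} (hA : ∀ t i j, 0 ≤ A t i j)
    {i j : Fin n} : (infiniteFlowGraph A).Adj i j ↔
      i ≠ j ∧ ¬ Summable fun t => A t i j + A t j i := by
  rw [not_summable_iff_tendsto_nat_atTop_of_nonneg fun t => add_nonneg (hA t i j) (hA t j i)]
  rfl

/-- Along a trajectory with summable disagreement, the ends of an edge of the infinite flow graph
merge. -/
theorem IsTrajectory.tendsto_sub_of_adj {A : ℕ → Matrix (Fin n) (Fin n) ℝ} {s : ℕ}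
    {x : ℕ → Fin n → ℝ} (hx : IsTrajectory A s x)
    (hA : ∀ t, A t ∈ Matrix.rowStochastic ℝ (Fin n))
    (hD : Summable fun t => disagreement (A t) (x t)) {i j : Fin n}
    (hij : (infiniteFlowGraph A).Adj i j) : Tendsto (fun t => x t i - x t j) atTop (𝓝 0) := by
  obtain ⟨l, hl⟩ := hx.exists_tendsto hA hD
  have hlim : Tendsto (fun t => x t i - x t j) atTop (𝓝 (l i - l j)) :=
    (tendsto_pi_nhds.1 hl i).sub (tendsto_pi_nhds.1 hl j)
  rw [infiniteFlowGraph_adj_iff fun t => (hA t).1] at hij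
  by_cases hne : l i - l j = 0
  · rwa [hne] at hlim
  exfalso
  apply hij.2
  have hpos : 0 < (l i - l j) ^ 2 := by positivity
  have hev := (hlim.pow 2).eventually (lt_mem_nhds (half_lt_self hpos))
  -- If the limits differ, then eventually `(x t i - x t j) ^ 2` exceeds half its limit, so
  -- disagreement controls each of the two weights; hence the factor `4 = 2 * 2`.
  refine Summable.of_norm_bounded_eventually_nat (g := fun t =>
    4 / (l i - l j) ^ 2 * disagreement (A t) (x t)) (hD.mul_left _) ?_
  filter_upwards [hev] with t ht
  have h1 := mul_le_disagreement (hA t).1 (x t) i j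
  have h2 := mul_le_disagreement (hA t).1 (x t) j i
  have h3 := add_nonneg ((hA t).1 i j) ((hA t).1 j i)
  rw [Real.norm_of_nonneg h3, div_mul_eq_mul_div, le_div_iff₀ hpos]
  have h4 := mul_le_mul_of_nonneg_left ht.le h3
  have h5 : (x t j - x t i) ^ 2 = (x t i - x t j) ^ 2 := by ring
  rw [h5] at h2
  linarith

lemma IsTrajectory.eq_transition {A : ℕ → Matrix (Fin n) (Fin n) ℝ} {s : ℕ}
    {x : ℕ → Fin n → ℝ} (hx : IsTrajectory A s x) (k : ℕ) :
    x (s + k) = (transition A s k).mulVec (x s) := by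
  induction k with
  | zero => simp [transition]
  | succ k ih =>
    rw [← add_assoc, hx (s + k) (by omega), ih, transition_succ, Matrix.mulVec_mulVec]

lemma isTrajectory_transition (A : ℕ → Matrix (Fin n) (Fin n) ℝ) (s : ℕ) (v : Fin n → ℝ) :
    IsTrajectory A s fun t => (transition A s (t - s)).mulVec v := by
  intro t ht
  beta_reduce
  rw [show t + 1 - s = t - s + 1 by omega, transition_succ, Matrix.mulVec_mulVec,
    show s + (t - s) = t by omega]

lemma isTrajectory_transition_col (A : ℕ → Matrix (Fin n) (Fin n) ℝ) (s : ℕ) (l : Fin n) :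
    IsTrajectory A s fun t i => transition A s (t - s) i l := by
  intro t ht
  ext i
  change transition A s (t + 1 - s) i l = _
  rw [show t + 1 - s = t - s + 1 by omega, transition_succ, show s + (t - s) = t by omega]
  rfl

/-- For infinite flow stability it suffices that the trajectories from the basis vectors have summable
disagreement. -/
theorem infiniteFlowStable_of_summable {A : ℕ → Matrix (Fin n) (Fin n) ℝ}
    (hA : ∀ t, A t ∈ Matrix.rowStochastic ℝ (Fin n))
    (hD : ∀ s l, Summable fun k =>
      disagreement (A (s + k)) fun i => transition A s k i l) : InfiniteFlowStable A := by
  intro s x hx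
  have hD' : ∀ l, Summable fun t => disagreement (A t) fun i => transition A s (t - s) i l := by
    intro l
    rw [← summable_nat_add_iff s]
    refine (hD s l).congr fun k => ?_
    rw [Nat.add_sub_cancel, add_comm]
  have hxeq : ∀ i, (fun t => x t i) =ᶠ[atTop]
      fun t => ∑ l, transition A s (t - s) i l * x s l := by
    intro i
    filter_upwards [eventually_ge_atTop s] with t ht
    have := hx.eq_transition (t - s)
    rw [Nat.add_sub_cancel' ht] at this
    rw [this]
    rfl
  constructor
  · choose L hL using fun l => (isTrajectory_transition_col A s l).exists_tendsto hA (hD' l)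
    refine ⟨fun i => ∑ l, L l i * x s l, tendsto_pi_nhds.2 fun i => ?_⟩
    refine Tendsto.congr' (hxeq i).symm (tendsto_finsetSum _ fun l _ => ?_)
    exact (tendsto_pi_nhds.1 (hL l) i).mul_const _
  · intro i j hij
    have h : Tendsto (fun t => ∑ l, (transition A s (t - s) i l - transition A s (t - s) j l) *
        x s l) atTop (𝓝 (∑ l, 0 * x s l)) := tendsto_finsetSum _ fun l _ =>
      ((isTrajectory_transition_col A s l).tendsto_sub_of_adj hA (hD' l) hij).mul_const _
    simp only [zero_mul, Finset.sum_const_zero] at h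
    refine Tendsto.congr' ?_ h
    filter_upwards [hxeq i, hxeq j] with t h1 h2
    rw [h1, h2, ← Finset.sum_sub_distrib]
    exact Finset.sum_congr rfl fun l _ => by ring

/-! ### Mutual ergodicity and components of the flow graph -/

lemma InfiniteFlowStable.mutuallyErgodic_of_reachable {A : ℕ → Matrix (Fin n) (Fin n) ℝ}
    (hA : InfiniteFlowStable A) {i j : Fin n} (h : (infiniteFlowGraph A).Reachable i j) :
    MutuallyErgodic A i j := by
  intro s x hx
  obtain ⟨w⟩ := h
  induction w with
  | nil => simp
  | cons hadj _ ih => simpa using ((hA s x hx).2 _ _ hadj).add ih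

/-- Mutually ergodic indices lie in the same component of the infinite flow graph. -/
theorem reachable_of_mutuallyErgodic {A : ℕ → Matrix (Fin n) (Fin n) ℝ}
    (hA : ∀ t, A t ∈ Matrix.rowStochastic ℝ (Fin n)) {i j : Fin n} (h : MutuallyErgodic A i j) :
    (infiniteFlowGraph A).Reachable i j := by
  classical
  by_contra hij
  set C : Finset (Fin n) := Finset.univ.filter fun k => (infiniteFlowGraph A).Reachable i k with hC
  have hsum : ∀ a ∈ C, ∀ b ∈ Cᶜ, Summable fun t => A t a b + A t b a := by
    intro a ha b hb
    simp only [hC, Finset.mem_compl, Finset.mem_filter, Finset.mem_univ, true_and] at ha hb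
    by_contra hns
    have hne : a ≠ b := by rintro rfl; exact hb ha
    exact hb (ha.trans
      ((infiniteFlowGraph_adj_iff fun t => (hA t).1).2 ⟨hne, hns⟩).reachable)
  have hF : Summable fun t => cutWeight (A t) C + cutWeight (A t) Cᶜ := by
    refine Summable.add (summable_sum fun a ha => summable_sum fun b hb => ?_)
      (summable_sum fun b hb => summable_sum fun a ha => ?_)
    · exact Summable.of_nonneg_of_le (fun t => (hA t).1 a b)
        (fun t => le_add_of_nonneg_right ((hA t).1 b a)) (hsum a ha b hb)
    · rw [compl_compl] at ha
      exact Summable.of_nonneg_of_le (fun t => (hA t).1 b a)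
        (fun t => le_add_of_nonneg_left ((hA t).1 a b)) (hsum a ha b hb)
  have hF0 : ∀ t, 0 ≤ cutWeight (A t) C + cutWeight (A t) Cᶜ := fun t =>
    add_nonneg (cutWeight_nonneg (hA t).1 _) (cutWeight_nonneg (hA t).1 _)
  -- The component of `i` exchanges finite total weight with the rest. After time `N` at most `1 /
  -- 4` remains, so values starting at `1` and `0` keep a distance of at least `1 / 2`.
  obtain ⟨N, hN⟩ := exists_sum_Ico_le hF hF0 (show (0 : ℝ) < 1 / 4 by norm_num)
  have hN := hN N le_rfl
  set v : Fin n → ℝ := fun k => if k ∈ C then 1 else 0 with hv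
  set x := fun t => (transition A N (t - N)).mulVec v with hxdef
  have hx : IsTrajectory A N x := isTrajectory_transition A N v
  have hx0 : x N = v := by simp [hxdef, transition]
  have hinv : ∀ t, N ≤ t → (∀ k, 0 ≤ x t k ∧ x t k ≤ 1) ∧
      (∀ k ∈ C, 1 - ∑ r ∈ Finset.Ico N t, (cutWeight (A r) C + cutWeight (A r) Cᶜ) ≤ x t k) ∧
      ∀ k ∈ Cᶜ, x t k ≤ ∑ r ∈ Finset.Ico N t, (cutWeight (A r) C + cutWeight (A r) Cᶜ) := by
    intro t ht
    induction t, ht using Nat.le_induction with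
    | base =>
      rw [hx0]
      refine ⟨fun k => ?_, fun k hk => ?_, fun k hk => ?_⟩
      · simp only [hv]; split_ifs <;> norm_num
      · simp [hv, hk]
      · rw [Finset.mem_compl] at hk; simp [hv, hk]
    | succ t ht ih =>
      obtain ⟨ih0, ih1, ih2⟩ := ih
      have hP0 : 0 ≤ ∑ r ∈ Finset.Ico N t, (cutWeight (A r) C + cutWeight (A r) Cᶜ) :=
        Finset.sum_nonneg fun r _ => hF0 r
      rw [Finset.sum_Ico_succ_top ht, hx t ht]
      set P := ∑ r ∈ Finset.Ico N t, (cutWeight (A r) C + cutWeight (A r) Cᶜ)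
      have hc1 := cutWeight_nonneg (hA t).1 C
      have hc2 := cutWeight_nonneg (hA t).1 Cᶜ
      have hrow : ∀ k, ∑ l ∈ C, A t k l + ∑ l ∈ Cᶜ, A t k l = 1 := fun k => by
        rw [Finset.sum_add_sum_compl, Matrix.sum_row_of_mem_rowStochastic (hA t)]
      have hmv : ∀ k, (A t).mulVec (x t) k =
          ∑ l ∈ C, A t k l * x t l + ∑ l ∈ Cᶜ, A t k l * x t l := fun k => by
        rw [Finset.sum_add_sum_compl]; rfl
      refine ⟨fun k => ⟨?_, ?_⟩, fun k hk => ?_, fun k hk => ?_⟩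
      · exact Matrix.nonneg_mulVec_of_mem_rowStochastic (hA t) (fun l => (ih0 l).1) k
      · rw [← Matrix.sum_row_of_mem_rowStochastic (hA t) k]
        change ∑ l, A t k l * x t l ≤ _
        exact Finset.sum_le_sum fun l _ =>
          mul_le_of_le_one_right ((hA t).1 k l) (ih0 l).2
      · have hu := sum_compl_le_cutWeight (hA t).1 hk
        have hu0 : 0 ≤ ∑ l ∈ Cᶜ, A t k l := Finset.sum_nonneg fun l _ => (hA t).1 k l
        have e1 : (∑ l ∈ C, A t k l) * (1 - P) ≤ ∑ l ∈ C, A t k l * x t l := by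
          rw [Finset.sum_mul]
          exact Finset.sum_le_sum fun l hl =>
            mul_le_mul_of_nonneg_left (ih1 l hl) ((hA t).1 k l)
        have e2 : 0 ≤ ∑ l ∈ Cᶜ, A t k l * x t l :=
          Finset.sum_nonneg fun l _ => mul_nonneg ((hA t).1 k l) (ih0 l).1
        rw [hmv]
        have := mul_nonneg hu0 hP0
        nlinarith [hrow k]
      · have hu := sum_compl_le_cutWeight (hA t).1 hk
        rw [compl_compl] at hu
        have hu0 : 0 ≤ ∑ l ∈ C, A t k l := Finset.sum_nonneg fun l _ => (hA t).1 k l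
        have e1 : ∑ l ∈ C, A t k l * x t l ≤ ∑ l ∈ C, A t k l :=
          Finset.sum_le_sum fun l _ => mul_le_of_le_one_right ((hA t).1 k l) (ih0 l).2
        have e2 : ∑ l ∈ Cᶜ, A t k l * x t l ≤ (∑ l ∈ Cᶜ, A t k l) * P := by
          rw [Finset.sum_mul]
          exact Finset.sum_le_sum fun l hl =>
            mul_le_mul_of_nonneg_left (ih2 l hl) ((hA t).1 k l)
        rw [hmv]
        have := mul_nonneg hu0 hP0
        nlinarith [hrow k]
  have hiC : i ∈ C := by simp [hC]
  have hjC : j ∈ Cᶜ := by simpa [hC] using hij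
  have hge : ∀ t, N ≤ t → 1 / 2 ≤ x t i - x t j := by
    intro t ht
    have h1 := (hinv t ht).2.1 i hiC
    have h2 := (hinv t ht).2.2 j hjC
    have h3 := hN t
    linarith
  have := ge_of_tendsto (h N x hx) (eventually_atTop.2 ⟨N, hge⟩)
  norm_num at this

theorem InfiniteFlowStable.mutuallyErgodic_iff_reachable {A : ℕ → Matrix (Fin n) (Fin n) ℝ}
    (h : InfiniteFlowStable A) (hA : ∀ t, A t ∈ Matrix.rowStochastic ℝ (Fin n)) (i j : Fin n) :
    MutuallyErgodic A i j ↔ (infiniteFlowGraph A).Reachable i j :=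
  ⟨reachable_of_mutuallyErgodic hA, h.mutuallyErgodic_of_reachable⟩

end Convergence

/-! ### Measurability, independence and the quadratic estimate -/

section Random

variable {n : ℕ} {Ω : Type*} [MeasurableSpace Ω] {μ : Measure Ω}

lemma measurable_matrix_entry (i j : Fin n) :
    Measurable fun M : Matrix (Fin n) (Fin n) ℝ => M i j := by
  have h : Measurable fun f : Fin n → Fin n → ℝ => f i j :=
    (measurable_pi_apply j).comp (measurable_pi_apply i)
  exact h

lemma measurable_matrix_of_entries {α : Type*} [MeasurableSpace α]
    {f : α → Matrix (Fin n) (Fin n) ℝ} (h : ∀ i j, Measurable fun a => f a i j) :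
    Measurable f := by
  have : @Measurable α (Fin n → Fin n → ℝ) _ _ f :=
    measurable_pi_lambda _ fun i => measurable_pi_lambda _ fun j => h i j
  exact this

lemma measurable_transition {α : Type*} [MeasurableSpace α]
    {G : ℕ → α → Matrix (Fin n) (Fin n) ℝ} (hG : ∀ t, Measurable (G t)) (s k : ℕ) :
    Measurable fun a => transition (fun t => G t a) s k := by
  induction k with
  | zero => exact measurable_const
  | succ k ih =>
    refine measurable_matrix_of_entries fun i j => ?_
    simp only [transition_succ, Matrix.mul_apply]
    exact Finset.measurable_fun_sum _ fun l _ =>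
      ((measurable_matrix_entry i l).comp (hG _)).mul ((measurable_matrix_entry l j).comp ih)

lemma transition_congr {A B : ℕ → Matrix (Fin n) (Fin n) ℝ} {s k : ℕ}
    (h : ∀ t ∈ Finset.Ico s (s + k), A t = B t) : transition A s k = transition B s k := by
  induction k with
  | zero => rfl
  | succ k ih =>
    rw [transition_succ, transition_succ, ih fun t ht => h t ?_, h (s + k) ?_]
    · simp
    · rw [Finset.mem_Ico] at ht ⊢
      omega

/-- The variance of a probability vector is at least the contribution of the pairs containing `i`. -/
lemma sq_mulVec_add_le {M : Matrix (Fin n) (Fin n) ℝ} (hM : M ∈ Matrix.rowStochastic ℝ (Fin n))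
    (y : Fin n → ℝ) (i : Fin n) :
    M.mulVec y i ^ 2 + ∑ j, M i i * M i j * (y i - y j) ^ 2 ≤ ∑ j, M i j * y j ^ 2 := by
  have hrow := Matrix.sum_row_of_mem_rowStochastic hM i
  set z : Fin n → ℝ := fun j => y i - y j with hz
  have hmv : M.mulVec y i = y i - ∑ j, M i j * z j := by
    simp only [Matrix.mulVec, dotProduct, hz, mul_sub, Finset.sum_sub_distrib, ← Finset.sum_mul,
      hrow, one_mul, sub_sub_cancel]
  have hsq : ∑ j, M i j * y j ^ 2 =
      y i ^ 2 - 2 * y i * ∑ j, M i j * z j + ∑ j, M i j * z j ^ 2 := by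
    have : ∀ j, M i j * y j ^ 2 =
        M i j * y i ^ 2 - 2 * y i * (M i j * z j) + M i j * z j ^ 2 := fun j => by
      simp only [hz]; ring
    simp only [this, Finset.sum_add_distrib, Finset.sum_sub_distrib, ← Finset.mul_sum,
      ← Finset.sum_mul, hrow, one_mul]
  have hM' : ∑ j ∈ Finset.univ.erase i, M i j = 1 - M i i := by
    rw [← hrow, ← Finset.add_sum_erase _ _ (Finset.mem_univ i)]
    ring
  -- Since `z i = 0`, only off-diagonal entries count; their mass is `1 - M i i`, and Cauchy–Schwarz
  -- gains exactly the factor that leaves `M i i * ∑ j, M i j * z j ^ 2` in the variance.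
  have hcs : (∑ j, M i j * z j) ^ 2 ≤ (1 - M i i) * ∑ j, M i j * z j ^ 2 := by
    have hzi : z i = 0 := sub_self _
    rw [← Finset.add_sum_erase _ (fun j => M i j * z j) (Finset.mem_univ i),
      ← Finset.add_sum_erase _ (fun j => M i j * z j ^ 2) (Finset.mem_univ i), ← hM', hzi]
    simp only [mul_zero, zero_add, ne_eq, OfNat.ofNat_ne_zero, not_false_eq_true, zero_pow]
    exact Finset.sum_sq_le_sum_mul_sum_of_sq_le_mul _ (fun j _ => hM.1 i j)
      (fun j _ => mul_nonneg (hM.1 i j) (sq_nonneg _)) fun j _ => le_of_eq (by ring)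
  have hfb : ∑ j, M i i * M i j * (y i - y j) ^ 2 = M i i * ∑ j, M i j * z j ^ 2 := by
    rw [Finset.mul_sum]
    exact Finset.sum_congr rfl fun j _ => by simp only [hz]; ring
  rw [hfb, hmv, hsq]
  nlinarith

namespace IsIndependentRandomChain

variable {A : ℕ → Ω → Matrix (Fin n) (Fin n) ℝ}

lemma measurable_entry (hA : IsIndependentRandomChain μ A) (t : ℕ) (i j : Fin n) :
    Measurable fun ω => A t ω i j :=
  (measurable_matrix_entry i j).comp (hA.measurable t)

lemma integrable_entry [IsProbabilityMeasure μ] (hA : IsIndependentRandomChain μ A) (t : ℕ)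
    (i j : Fin n) : Integrable (fun ω => A t ω i j) μ := by
  refine Integrable.of_bound (hA.measurable_entry t i j).aestronglyMeasurable 1 ?_
  filter_upwards [hA.stochastic t] with ω h
  rw [Real.norm_of_nonneg (h.1 i j)]
  exact Matrix.le_one_of_mem_rowStochastic h

lemma integrable_diag_mul_entry [IsProbabilityMeasure μ] (hA : IsIndependentRandomChain μ A)
    (t : ℕ) (i j : Fin n) : Integrable (fun ω => A t ω i i * A t ω i j) μ := by
  refine Integrable.of_bound
    ((hA.measurable_entry t i i).mul (hA.measurable_entry t i j)).aestronglyMeasurable 1 ?_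
  filter_upwards [hA.stochastic t] with ω h
  rw [Real.norm_of_nonneg (mul_nonneg (h.1 i i) (h.1 i j))]
  exact mul_le_one₀ (Matrix.le_one_of_mem_rowStochastic h) (h.1 i j)
    (Matrix.le_one_of_mem_rowStochastic h)

lemma expectedChain_mem [IsProbabilityMeasure μ] (hA : IsIndependentRandomChain μ A) (t : ℕ) :
    expectedChain μ A t ∈ Matrix.rowStochastic ℝ (Fin n) := by
  rw [Matrix.mem_rowStochastic_iff_sum]
  simp only [expectedChain, Matrix.of_apply]
  constructor
  · intro i j
    refine integral_nonneg_of_ae ?_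
    filter_upwards [hA.stochastic t] with ω h using h.1 i j
  · intro i
    rw [← integral_finsetSum _ fun j _ => hA.integrable_entry t i j]
    have : (fun ω => ∑ j, A t ω i j) =ᵐ[μ] fun _ => (1 : ℝ) := by
      filter_upwards [hA.stochastic t] with ω h
      exact Matrix.sum_row_of_mem_rowStochastic h i
    rw [integral_congr_ae this]
    simp

lemma integral_diag_mul_le [IsProbabilityMeasure μ] (hA : IsIndependentRandomChain μ A) (t : ℕ)
    (i j : Fin n) : ∫ ω, A t ω i i * A t ω i j ∂μ ≤ expectedChain μ A t i i := by
  refine integral_mono_ae (hA.integrable_diag_mul_entry t i j) (hA.integrable_entry t i i) ?_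
  filter_upwards [hA.stochastic t] with ω h
  exact mul_le_of_le_one_right (h.1 i i) (Matrix.le_one_of_mem_rowStochastic h)

/-- Under the feedback property, the expected chain has uniformly positive diagonal. -/
lemma le_expectedChain_diag [IsProbabilityMeasure μ] (hA : IsIndependentRandomChain μ A) {γ : ℝ}
    (hγ : 0 < γ) (hfb : ∀ (t : ℕ) (i j : Fin n), i ≠ j →
      γ * ∫ ω, A t ω i j ∂μ ≤ ∫ ω, A t ω i i * A t ω i j ∂μ) (t : ℕ) (i : Fin n) :
    γ / (n + γ) ≤ expectedChain μ A t i i := by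
  have hmem := hA.expectedChain_mem t
  have hrow := Matrix.sum_row_of_mem_rowStochastic hmem i
  have h0 := hmem.1 i i
  -- Summing over `j` the bounds `γ ā_ij ≤ E[a_ii a_ij] ≤ ā_ii` for `j ≠ i`, with `γ ā_ii` for the
  -- diagonal term, gives `γ ≤ (n + γ) ā_ii`.
  have h : ∑ j, γ * expectedChain μ A t i j ≤
      ∑ j, (expectedChain μ A t i i + if i = j then γ * expectedChain μ A t i i else 0) := by
    refine Finset.sum_le_sum fun j _ => ?_
    split_ifs with hij
    · subst hij
      linarith
    · rw [add_zero]
      exact (hfb t i j hij).trans (hA.integral_diag_mul_le t i j)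
  rw [← Finset.mul_sum, hrow, Finset.sum_add_distrib, Finset.sum_ite_eq] at h
  simp only [Finset.sum_const, Finset.card_univ, Fintype.card_fin, nsmul_eq_mul, Finset.mem_univ,
    if_true] at h
  rw [div_le_iff₀ (by positivity)]
  linarith

/-- The past of an independent chain is independent of its present. -/
lemma indepFun_transition (hA : IsIndependentRandomChain μ A) (s k : ℕ) :
    IndepFun (fun ω => transition (fun t => A t ω) s k) (A (s + k)) μ := by
  have h := hA.indep.indepFun_finset (Finset.Ico s (s + k)) {s + k} (by simp) hA.measurable
  -- The default matrix `1` outside the window never enters the product.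
  have hφ : Measurable fun f : Finset.Ico s (s + k) → Matrix (Fin n) (Fin n) ℝ =>
      transition (fun t => if ht : t ∈ Finset.Ico s (s + k) then f ⟨t, ht⟩ else 1) s k := by
    refine measurable_transition (G := fun t (f : Finset.Ico s (s + k) → _) =>
      if ht : t ∈ Finset.Ico s (s + k) then f ⟨t, ht⟩ else 1) (fun t => ?_) s k
    by_cases ht : t ∈ Finset.Ico s (s + k)
    · simp only [ht, dif_pos]
      exact measurable_pi_apply _
    · simp only [ht, dif_neg, not_false_eq_true]
      exact measurable_const
  have hψ : Measurable fun f : ({s + k} : Finset ℕ) → Matrix (Fin n) (Fin n) ℝ =>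
      f ⟨s + k, Finset.mem_singleton_self _⟩ := measurable_pi_apply _
  have heq : (fun ω => transition (fun t => A t ω) s k) =
      (fun f : Finset.Ico s (s + k) → Matrix (Fin n) (Fin n) ℝ =>
        transition (fun t => if ht : t ∈ Finset.Ico s (s + k) then f ⟨t, ht⟩ else 1) s k) ∘
      fun ω t => A t ω := by
    ext ω : 1
    exact transition_congr fun t ht => by simp only [ht, dif_pos]
  rw [heq]
  exact h.comp hφ hψ

lemma ae_stochastic (hA : IsIndependentRandomChain μ A) :
    ∀ᵐ ω ∂μ, ∀ t, A t ω ∈ Matrix.rowStochastic ℝ (Fin n) :=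
  ae_all_iff.2 hA.stochastic

/-- One step of the quadratic comparison function, row by row. -/
lemma integral_sq_mulVec_add_le [IsProbabilityMeasure μ] (hA : IsIndependentRandomChain μ A)
    {γ : ℝ} (hfb : ∀ (t : ℕ) (i j : Fin n), i ≠ j →
      γ * ∫ ω, A t ω i j ∂μ ≤ ∫ ω, A t ω i i * A t ω i j ∂μ) {t : ℕ} {Y : Ω → Fin n → ℝ}
    (hY : Measurable Y) (hY01 : ∀ᵐ ω ∂μ, ∀ i, 0 ≤ Y ω i ∧ Y ω i ≤ 1)
    (hind : IndepFun Y (A t) μ) (i : Fin n) :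
    ∫ ω, (A t ω).mulVec (Y ω) i ^ 2 ∂μ + γ * ∫ ω, ∑ j, A t ω i j * (Y ω i - Y ω j) ^ 2 ∂μ ≤
      ∑ j, expectedChain μ A t i j * ∫ ω, Y ω j ^ 2 ∂μ := by
  have hYm : ∀ j, Measurable fun ω => Y ω j := fun j => (measurable_pi_apply j).comp hY
  have hAm := hA.measurable_entry t
  have hmv : Measurable fun ω => (A t ω).mulVec (Y ω) i := by
    simp only [Matrix.mulVec, dotProduct]
    exact Finset.measurable_fun_sum _ fun j _ => (hAm i j).mul (hYm j)
  have iY : ∀ j, Integrable (fun ω => Y ω j ^ 2) μ := fun j => by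
    refine Integrable.of_bound ((hYm j).pow_const 2).aestronglyMeasurable 1 ?_
    filter_upwards [hY01] with ω h
    rw [Real.norm_of_nonneg (sq_nonneg _)]
    exact pow_le_one₀ (h j).1 (h j).2
  have iYd : ∀ j, Integrable (fun ω => (Y ω i - Y ω j) ^ 2) μ := fun j => by
    refine Integrable.of_bound (((hYm i).sub (hYm j)).pow_const 2).aestronglyMeasurable 1 ?_
    filter_upwards [hY01] with ω h
    rw [Real.norm_of_nonneg (sq_nonneg _), sq_le_one_iff_abs_le_one, abs_le]
    have := h i; have := h j
    constructor <;> linarith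
  have hdiff : ∀ j, Measurable fun y : Fin n → ℝ => (y i - y j) ^ 2 := fun j =>
    ((measurable_pi_apply i).sub (measurable_pi_apply j)).pow_const 2
  have hprod : ∀ j, Measurable fun M : Matrix (Fin n) (Fin n) ℝ => M i i * M i j := fun j =>
    (measurable_matrix_entry i i).mul (measurable_matrix_entry i j)
  have ind1 : ∀ j, IndepFun (fun ω => A t ω i j) (fun ω => Y ω j ^ 2) μ := fun j =>
    hind.symm.comp (measurable_matrix_entry i j) ((measurable_pi_apply j).pow_const 2)
  have ind2 : ∀ j, IndepFun (fun ω => A t ω i j) (fun ω => (Y ω i - Y ω j) ^ 2) μ := fun j =>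
    hind.symm.comp (measurable_matrix_entry i j) (hdiff j)
  have ind3 : ∀ j, IndepFun (fun ω => A t ω i i * A t ω i j)
      (fun ω => (Y ω i - Y ω j) ^ 2) μ := fun j =>
    hind.symm.comp (hprod j) (hdiff j)
  have i1 : ∀ j, Integrable (fun ω => A t ω i j * Y ω j ^ 2) μ := fun j =>
    (ind1 j).integrable_mul (hA.integrable_entry t i j) (iY j)
  have i2 : ∀ j, Integrable (fun ω => A t ω i j * (Y ω i - Y ω j) ^ 2) μ := fun j =>
    (ind2 j).integrable_mul (hA.integrable_entry t i j) (iYd j)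
  have i3 : ∀ j, Integrable (fun ω => A t ω i i * A t ω i j * (Y ω i - Y ω j) ^ 2) μ := fun j =>
    (ind3 j).integrable_mul (hA.integrable_diag_mul_entry t i j) (iYd j)
  have i4 : Integrable (fun ω => (A t ω).mulVec (Y ω) i ^ 2) μ := by
    refine Integrable.of_bound (hmv.pow_const 2).aestronglyMeasurable 1 ?_
    filter_upwards [hY01, hA.stochastic t] with ω h hs
    rw [Real.norm_of_nonneg (sq_nonneg _)]
    refine pow_le_one₀ (Matrix.nonneg_mulVec_of_mem_rowStochastic hs (fun j => (h j).1) i) ?_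
    rw [← Matrix.sum_row_of_mem_rowStochastic hs i]
    change ∑ j, A t ω i j * Y ω j ≤ _
    exact Finset.sum_le_sum fun j _ => mul_le_of_le_one_right (hs.1 i j) (h j).2
  -- Independence splits off `E[(Y_i - Y_j)²]`, so feedback can be applied to the matrix factor
  -- alone; the term `j = i` vanishes.
  have hfbi : γ * ∫ ω, ∑ j, A t ω i j * (Y ω i - Y ω j) ^ 2 ∂μ ≤
      ∫ ω, ∑ j, A t ω i i * A t ω i j * (Y ω i - Y ω j) ^ 2 ∂μ := by
    rw [integral_finsetSum _ fun j _ => i2 j, integral_finsetSum _ fun j _ => i3 j,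
      Finset.mul_sum]
    refine Finset.sum_le_sum fun j _ => ?_
    rcases eq_or_ne i j with rfl | hij
    · simp
    · rw [(ind2 j).integral_fun_mul_eq_mul_integral (hAm i j).aestronglyMeasurable
          (iYd j).aestronglyMeasurable,
        (ind3 j).integral_fun_mul_eq_mul_integral ((hAm i i).mul (hAm i j)).aestronglyMeasurable
          (iYd j).aestronglyMeasurable, ← mul_assoc]
      exact mul_le_mul_of_nonneg_right (hfb t i j hij) (integral_nonneg fun ω => sq_nonneg _)
  have hmain : ∫ ω, (A t ω).mulVec (Y ω) i ^ 2 ∂μ +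
      ∫ ω, ∑ j, A t ω i i * A t ω i j * (Y ω i - Y ω j) ^ 2 ∂μ ≤
      ∫ ω, ∑ j, A t ω i j * Y ω j ^ 2 ∂μ := by
    rw [← integral_add i4 (integrable_finsetSum _ fun j _ => i3 j)]
    refine integral_mono_ae (i4.add (integrable_finsetSum _ fun j _ => i3 j))
      (integrable_finsetSum _ fun j _ => i1 j) ?_
    filter_upwards [hA.stochastic t] with ω hs using sq_mulVec_add_le hs (Y ω) i
  have heq : ∫ ω, ∑ j, A t ω i j * Y ω j ^ 2 ∂μ =
      ∑ j, expectedChain μ A t i j * ∫ ω, Y ω j ^ 2 ∂μ := by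
    rw [integral_finsetSum _ fun j _ => i1 j]
    exact Finset.sum_congr rfl fun j _ =>
      (ind1 j).integral_fun_mul_eq_mul_integral (hAm i j).aestronglyMeasurable
        (iY j).aestronglyMeasurable
  linarith

end IsIndependentRandomChain

/-- By Tonelli the sum has finite expectation, hence is finite almost surely. -/
lemma ae_summable_of_sum_integral_le {f : ℕ → Ω → ℝ} (h0 : ∀ k, 0 ≤ᵐ[μ] f k)
    (hf : ∀ k, Integrable (f k) μ) {C : ℝ} (hC : ∀ K, ∑ k ∈ Finset.range K, ∫ ω, f k ω ∂μ ≤ C) :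
    ∀ᵐ ω ∂μ, Summable fun k => f k ω := by
  have hs : Summable fun k => ∫ ω, f k ω ∂μ :=
    summable_of_sum_range_le (fun k => integral_nonneg_of_ae (h0 k)) hC
  have hlt : ∫⁻ ω, ∑' k, ENNReal.ofReal (f k ω) ∂μ ≠ ⊤ := by
    rw [lintegral_tsum fun k => (hf k).aemeasurable.ennreal_ofReal]
    simp_rw [← ofReal_integral_eq_lintegral_ofReal (hf _) (h0 _)]
    exact hs.tsum_ofReal_ne_top
  have hmeas : AEMeasurable (fun ω => ∑' k, ENNReal.ofReal (f k ω)) μ :=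
    AEMeasurable.tsum fun k => (hf k).aemeasurable.ennreal_ofReal
  filter_upwards [ae_lt_top' hmeas hlt, ae_all_iff.2 h0] with ω h1 h2
  refine (ENNReal.summable_toReal h1.ne).congr fun k => ?_
  exact ENNReal.toReal_ofReal (h2 k)

end Random

/-! ### Stability of the realizations and of the expected chain -/

section Main

variable {n : ℕ} {Ω : Type*} [MeasurableSpace Ω] {μ : Measure Ω} [IsProbabilityMeasure μ]
  {A : ℕ → Ω → Matrix (Fin n) (Fin n) ℝ}

namespace IsIndependentRandomChain

/-- The expected total disagreement along the trajectories from the basis vectors is finite. -/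
theorem ae_summable_disagreement (hA : IsIndependentRandomChain μ A)
    (hfeedback : HasFeedbackProperty μ A) (hrecip : ApproxReciprocal (expectedChain μ A))
    (s : ℕ) (l : Fin n) : ∀ᵐ ω ∂μ, Summable fun k =>
      disagreement (A (s + k) ω) fun i => transition (fun t => A t ω) s k i l := by
  obtain ⟨γ, hγ, hfb⟩ := hfeedback
  obtain ⟨c, hc, hcost⟩ := hrecip.exists_pos_le_costate hA.expectedChain_mem
    (show 0 < γ / (n + γ) by positivity) (hA.le_expectedChain_diag hγ hfb)
  set Y : ℕ → Ω → Fin n → ℝ := fun k ω i => transition (fun t => A t ω) s k i l with hYdef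
  have hcol : Measurable fun M : Matrix (Fin n) (Fin n) ℝ => fun i => M i l :=
    measurable_pi_lambda _ fun i => measurable_matrix_entry i l
  have hYm : ∀ k, Measurable (Y k) := fun k => hcol.comp (measurable_transition hA.measurable s k)
  have hY01 : ∀ k, ∀ᵐ ω ∂μ, ∀ i, 0 ≤ Y k ω i ∧ Y k ω i ≤ 1 := fun k => by
    filter_upwards [hA.ae_stochastic] with ω h i
    have := transition_mem_rowStochastic h s k
    exact ⟨this.1 i l, Matrix.le_one_of_mem_rowStochastic this⟩
  have hind : ∀ k, IndepFun (Y k) (A (s + k)) μ := fun k =>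
    (hA.indepFun_transition s k).comp hcol measurable_id
  have hint : ∀ k i j,
      Integrable (fun ω => A (s + k) ω i j * (Y k ω i - Y k ω j) ^ 2) μ := fun k i j => by
    have hm : ∀ i, Measurable fun ω => Y k ω i := fun i => (measurable_pi_apply i).comp (hYm k)
    refine Integrable.of_bound ((hA.measurable_entry (s + k) i j).mul
      (((hm i).sub (hm j)).pow_const 2)).aestronglyMeasurable 1 ?_
    filter_upwards [hY01 k, hA.stochastic (s + k)] with ω h hs
    have h1 : (Y k ω i - Y k ω j) ^ 2 ≤ 1 := by
      rw [sq_le_one_iff_abs_le_one, abs_le]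
      have := h i; have := h j
      constructor <;> linarith
    rw [Real.norm_of_nonneg (mul_nonneg (hs.1 i j) (sq_nonneg _))]
    exact mul_le_one₀ (Matrix.le_one_of_mem_rowStochastic hs) (sq_nonneg _) h1
  have hrow0 : ∀ k i, 0 ≤ ∫ ω, ∑ j, A (s + k) ω i j * (Y k ω i - Y k ω j) ^ 2 ∂μ := fun k i => by
    refine integral_nonneg_of_ae ?_
    filter_upwards [hA.stochastic (s + k)] with ω hs
    exact Finset.sum_nonneg fun j _ => mul_nonneg (hs.1 i j) (sq_nonneg _)
  have hDeq : ∀ k, ∫ ω, disagreement (A (s + k) ω) (Y k ω) ∂μ =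
      ∑ i, ∫ ω, ∑ j, A (s + k) ω i j * (Y k ω i - Y k ω j) ^ 2 ∂μ := fun k =>
    integral_finsetSum _ fun i _ => integrable_finsetSum _ fun j _ => hint k i j
  refine ae_summable_of_sum_integral_le (C := n * n / (γ * c)) (fun k => ?_)
    (fun k => integrable_finsetSum _ fun i _ => integrable_finsetSum _ fun j _ => hint k i j)
    fun K => ?_
  · filter_upwards [hA.stochastic (s + k)] with ω hs using disagreement_nonneg hs.1 _
  -- The weights depend on the horizon `s + K`, but their bounds `c` and `n` do not, so neither does
  -- the bound on the telescoped sum.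
  set w := costate (expectedChain μ A) (s + K) with hw
  have hw0 : ∀ t i, 0 ≤ w t i := fun t i => costate_nonneg hA.expectedChain_mem _ _ _
  have hEsq0 : ∀ k i, 0 ≤ ∫ ω, Y k ω i ^ 2 ∂μ := fun k i => integral_nonneg fun ω => sq_nonneg _
  have hstep : ∀ k, k < K → γ * c * ∫ ω, disagreement (A (s + k) ω) (Y k ω) ∂μ ≤
      ∑ i, w (s + k) i * ∫ ω, Y k ω i ^ 2 ∂μ -
      ∑ i, w (s + (k + 1)) i * ∫ ω, Y (k + 1) ω i ^ 2 ∂μ := by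
    intro k hk
    have hone := fun i => hA.integral_sq_mulVec_add_le hfb (hYm k) (hY01 k) (hind k) i
    have hnext : ∀ ω i, Y (k + 1) ω i = (A (s + k) ω).mulVec (Y k ω) i := fun ω i => rfl
    simp only [← hnext] at hone
    have hwk : w (s + k) = Matrix.vecMul (w (s + (k + 1))) (expectedChain μ A (s + k)) :=
      costate_eq _ (by omega)
    have hsum : ∑ i, w (s + k) i * ∫ ω, Y k ω i ^ 2 ∂μ =
        ∑ i, w (s + (k + 1)) i * ∑ j, expectedChain μ A (s + k) i j * ∫ ω, Y k ω j ^ 2 ∂μ := by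
      change w (s + k) ⬝ᵥ (fun j => ∫ ω, Y k ω j ^ 2 ∂μ) = _
      rw [hwk, ← Matrix.dotProduct_mulVec]
      rfl
    rw [hsum, hDeq, ← Finset.sum_sub_distrib, Finset.mul_sum]
    refine Finset.sum_le_sum fun i _ => ?_
    have h1 := mul_le_mul_of_nonneg_left (hone i) (hw0 (s + (k + 1)) i)
    have h2 := mul_le_mul_of_nonneg_right (hcost (s + K) (s + (k + 1)) i (by omega))
      (mul_nonneg hγ.le (hrow0 k i))
    linarith
  have htel : γ * c * ∑ k ∈ Finset.range K, ∫ ω, disagreement (A (s + k) ω) (Y k ω) ∂μ ≤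
      ∑ i, w (s + 0) i * ∫ ω, Y 0 ω i ^ 2 ∂μ := by
    rw [Finset.mul_sum]
    refine (Finset.sum_le_sum fun k hk => hstep k (Finset.mem_range.1 hk)).trans ?_
    rw [Finset.sum_range_sub' fun k => ∑ i, w (s + k) i * ∫ ω, Y k ω i ^ 2 ∂μ]
    exact sub_le_self _ (Finset.sum_nonneg fun i _ => mul_nonneg (hw0 _ _) (hEsq0 _ _))
  have hinit : ∑ i, w (s + 0) i * ∫ ω, Y 0 ω i ^ 2 ∂μ ≤ n * n := by
    calc _ ≤ ∑ i : Fin n, (n : ℝ) := Finset.sum_le_sum fun i _ => by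
          have h1 : ∫ ω, Y 0 ω i ^ 2 ∂μ ≤ 1 := by
            simp only [hYdef, transition, integral_const, probReal_univ, one_smul,
              Matrix.one_apply]
            split_ifs <;> norm_num
          calc _ ≤ (n : ℝ) * 1 := mul_le_mul (costate_le hA.expectedChain_mem _ _ _) h1
                (hEsq0 0 i) (Nat.cast_nonneg n)
            _ = n := mul_one _
      _ = n * n := by simp
  rw [le_div_iff₀ (by positivity)]
  linarith

/-- Almost every realization is infinite flow stable. -/
theorem ae_infiniteFlowStable (hA : IsIndependentRandomChain μ A)
    (hfeedback : HasFeedbackProperty μ A) (hrecip : ApproxReciprocal (expectedChain μ A)) :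
    ∀ᵐ ω ∂μ, InfiniteFlowStable fun t => A t ω := by
  -- Only countably many pairs of a starting time and a basis vector are involved, so the
  -- exceptional null sets can be united.
  have h : ∀ᵐ ω ∂μ, ∀ s l, Summable fun k =>
      disagreement (A (s + k) ω) fun i => transition (fun t => A t ω) s k i l :=
    ae_all_iff.2 fun s => ae_all_iff.2 fun l => hA.ae_summable_disagreement hfeedback hrecip s l
  filter_upwards [h, hA.ae_stochastic] with ω h1 h2 using infiniteFlowStable_of_summable h2 h1

/-- The expected chain, which is itself a (deterministic) independent chain, is infinite flow
stable. -/
theorem infiniteFlowStable_expectedChain (hA : IsIndependentRandomChain μ A)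
    (hfeedback : HasFeedbackProperty μ A) (hrecip : ApproxReciprocal (expectedChain μ A)) :
    InfiniteFlowStable (expectedChain μ A) := by
  have hB : IsIndependentRandomChain μ fun t (_ : Ω) => expectedChain μ A t :=
    { measurable := fun _ => measurable_const
      stochastic := fun t => ae_of_all _ fun _ => hA.expectedChain_mem t
      indep := hA.indep.comp (fun t _ => expectedChain μ A t) fun _ => measurable_const }
  have hexp : expectedChain μ (fun t (_ : Ω) => expectedChain μ A t) = expectedChain μ A := by
    ext t i j
    conv_lhs => rw [expectedChain]
    simp
  -- For a constant chain the expectation of the product is `ā_ii ā_ij`, so the lower bound on the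
  -- diagonal is itself a feedback constant.
  have hfb : HasFeedbackProperty μ fun t (_ : Ω) => expectedChain μ A t := by
    obtain ⟨γ, hγ, hfb⟩ := hfeedback
    refine ⟨γ / (n + γ), by positivity, fun t i j _ => ?_⟩
    simp only [integral_const, probReal_univ, one_smul]
    exact mul_le_mul_of_nonneg_right (hA.le_expectedChain_diag hγ hfb t i)
      ((hA.expectedChain_mem t).1 i j)
  obtain ⟨ω, hω⟩ := (hB.ae_infiniteFlowStable hfb (hexp.symm ▸ hrecip)).exists
  exact hω

end IsIndependentRandomChain

/-! ### Borel–Cantelli and equality of the flow graphs -/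

/-- A sum of independent random variables with values in `[0, b]` diverges almost surely if and only
if the sum of the expectations diverges. -/
theorem ae_tendsto_sum_atTop_iff_of_iIndepFun {X : ℕ → Ω → ℝ}
    (hX : ∀ t, Measurable (X t)) (hind : iIndepFun X μ) {b : ℝ}
    (hb : ∀ t, ∀ᵐ ω ∂μ, 0 ≤ X t ω ∧ X t ω ≤ b) :
    ∀ᵐ ω ∂μ, Tendsto (fun T => ∑ t ∈ Finset.range T, X t ω) atTop atTop ↔
      Tendsto (fun T => ∑ t ∈ Finset.range T, ∫ ω, X t ω ∂μ) atTop atTop := by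
  have hint : ∀ t, Integrable (X t) μ := fun t => by
    refine Integrable.of_bound (hX t).aestronglyMeasurable b ?_
    filter_upwards [hb t] with ω h
    rw [Real.norm_of_nonneg h.1]
    exact h.2
  have hsm : ∀ t, StronglyMeasurable (X t) := fun t => (hX t).stronglyMeasurable
  set ℱ := Filtration.natural X hsm with hℱ
  -- Summing through `X T` makes `f` adapted to the natural filtration with increment `X (T + 1)`;
  -- the missing first term is restored by `hshift` and `hshift'`.
  set f : ℕ → Ω → ℝ := fun T ω => ∑ t ∈ Finset.range (T + 1), X t ω with hf
  have hdiff : ∀ T ω, f (T + 1) ω - f T ω = X (T + 1) ω := fun T ω => by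
    simp only [hf, Finset.sum_range_succ _ (T + 1)]
    ring
  have hall : ∀ᵐ ω ∂μ, ∀ t, 0 ≤ X t ω ∧ X t ω ≤ b := ae_all_iff.2 hb
  have hadapt : StronglyAdapted ℱ f := fun T =>
    Finset.stronglyMeasurable_fun_sum _ fun t ht =>
      (Filtration.stronglyAdapted_natural hsm t).mono
        (ℱ.mono (Nat.lt_succ_iff.1 (Finset.mem_range.1 ht)))
  -- An increasing adapted process with bounded increments diverges exactly when its predictable
  -- part does; independence turns that part into the sum of the expectations.
  have key := tendsto_sum_indicator_atTop_iff (μ := μ) (ℱ := ℱ) (f := f) (R := b.toNNReal)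
    (by
      filter_upwards [hall] with ω h T
      have := hdiff T ω
      linarith [(h (T + 1)).1])
    hadapt (fun T => integrable_finsetSum _ fun t _ => hint t)
    (by
      filter_upwards [hall] with ω h T
      rw [hdiff, abs_of_nonneg (h (T + 1)).1]
      exact (h (T + 1)).2.trans (Real.le_coe_toNNReal b))
  have hcond : ∀ᵐ ω ∂μ, ∀ k, (μ[f (k + 1) - f k | ℱ k]) ω = ∫ ω, X (k + 1) ω ∂μ := by
    refine ae_all_iff.2 fun k => ?_
    have : f (k + 1) - f k = X (k + 1) := funext fun ω => hdiff k ω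
    rw [this]
    exact condExp_indep_eq (hX (k + 1)).comap_le (ℱ.le k)
      (comap_measurable (X (k + 1))).stronglyMeasurable
      (hind.indep_comap_natural_of_lt hsm (Nat.lt_succ_self k))
  filter_upwards [key, hcond] with ω h1 h2
  have hpred : ∀ T, predictablePart f ℱ μ T ω = ∑ k ∈ Finset.range T, ∫ ω, X (k + 1) ω ∂μ := by
    intro T
    simp only [predictablePart, Finset.sum_apply]
    exact Finset.sum_congr rfl fun k _ => h2 k
  simp only [hpred] at h1
  have hshift : Tendsto (fun T => ∑ t ∈ Finset.range T, X t ω) atTop atTop ↔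
      Tendsto (fun T => f T ω) atTop atTop :=
    (tendsto_add_atTop_iff_nat (f := fun T => ∑ t ∈ Finset.range T, X t ω) 1).symm
  have hshift' : Tendsto (fun T => ∑ t ∈ Finset.range T, ∫ ω, X t ω ∂μ) atTop atTop ↔
      Tendsto (fun T => ∑ k ∈ Finset.range T, ∫ ω, X (k + 1) ω ∂μ) atTop atTop := by
    rw [← tendsto_add_atTop_iff_nat (f := fun T => ∑ t ∈ Finset.range T, ∫ ω, X t ω ∂μ) 1]
    simp only [Finset.sum_range_succ']
    exact ⟨fun h => by
        simpa using tendsto_atTop_add_const_right _ (-∫ ω, X 0 ω ∂μ) h,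
      fun h => tendsto_atTop_add_const_right _ _ h⟩
  rw [hshift, hshift', h1]

/-- The infinite flow graph of almost every realization is that of the expected chain. -/
theorem IsIndependentRandomChain.ae_infiniteFlowGraph_eq (hA : IsIndependentRandomChain μ A) :
    ∀ᵐ ω ∂μ, infiniteFlowGraph (fun t => A t ω) = infiniteFlowGraph (expectedChain μ A) := by
  have h : ∀ᵐ ω ∂μ, ∀ i j : Fin n,
      Tendsto (fun T : ℕ => ∑ t ∈ Finset.range T, (A t ω i j + A t ω j i)) atTop atTop ↔
      Tendsto (fun T : ℕ => ∑ t ∈ Finset.range T,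
        (expectedChain μ A t i j + expectedChain μ A t j i)) atTop atTop := by
    refine ae_all_iff.2 fun i => ae_all_iff.2 fun j => ?_
    have hm : Measurable fun M : Matrix (Fin n) (Fin n) ℝ => M i j + M j i :=
      (measurable_matrix_entry i j).add (measurable_matrix_entry j i)
    have key := ae_tendsto_sum_atTop_iff_of_iIndepFun (b := 2)
      (X := fun t ω => A t ω i j + A t ω j i) (fun t => hm.comp (hA.measurable t))
      (hA.indep.comp (fun _ M => M i j + M j i) fun _ => hm) fun t => by
        filter_upwards [hA.stochastic t] with ω hs
        have h1 := Matrix.le_one_of_mem_rowStochastic hs (i := i) (j := j)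
        have h2 := Matrix.le_one_of_mem_rowStochastic hs (i := j) (j := i)
        exact ⟨add_nonneg (hs.1 i j) (hs.1 j i), by linarith⟩
    have he : ∀ t, ∫ ω, (A t ω i j + A t ω j i) ∂μ =
        expectedChain μ A t i j + expectedChain μ A t j i := fun t =>
      integral_add (hA.integrable_entry t i j) (hA.integrable_entry t j i)
    simpa only [he] using key
  filter_upwards [h] with ω hω
  ext i j
  exact and_congr_right fun _ => hω i j

end Main

theorem corollary2 {n : ℕ} {Ω : Type*} [MeasurableSpace Ω] (μ : Measure Ω)
    [IsProbabilityMeasure μ] (A : ℕ → Ω → Matrix (Fin n) (Fin n) ℝ)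
    (hA : IsIndependentRandomChain μ A) (hfeedback : HasFeedbackProperty μ A)
    (hrecip : ApproxReciprocal (expectedChain μ A)) :
    (∀ᵐ ω ∂μ, InfiniteFlowStable (fun t => A t ω)) ∧
    (∀ᵐ ω ∂μ, ∀ i j : Fin n,
      MutuallyErgodic (fun t => A t ω) i j ↔ MutuallyErgodic (expectedChain μ A) i j) ∧
    (∀ᵐ ω ∂μ, ∀ i j : Fin n,
      (infiniteFlowGraph (fun t => A t ω)).Reachable i j ↔
        (infiniteFlowGraph (expectedChain μ A)).Reachable i j) := by
  have hstable := hA.ae_infiniteFlowStable hfeedback hrecip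
  have hstable' := hA.infiniteFlowStable_expectedChain hfeedback hrecip
  have hgraph := hA.ae_infiniteFlowGraph_eq
  refine ⟨hstable, ?_, ?_⟩
  · filter_upwards [hstable, hgraph, hA.ae_stochastic] with ω h1 h2 h3 i j
    rw [h1.mutuallyErgodic_iff_reachable h3, h2,
      hstable'.mutuallyErgodic_iff_reachable hA.expectedChain_mem]
  · filter_upwards [hgraph] with ω h i j
    rw [h]
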